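/- Work in $\mathbb{R}^3$ with canonical basis $e_x,e_y,e_z$. A basic cube is a closed unit cube $p+[0,1]^3$ with $p\in\mathbb{Z}^3$; it is white if the sum of the coordinates of $p$ is even and black otherwise. A domino is the union of two basic cubes that share a face; for a domino $d$, let $v(d)$ be the center of its black cube minus the center of its white cube. A tiling of a set $R$ is a finite set of dominoes with pairwise disjoint interiors whose union is $R$; $R$ is tileable if it has a tiling. For $u\in\{e_x,e_y,e_z\}$ and a set $X$, let $S^u(X)$ be the interior of $(X+[0,\infty)u)\setminus X$. For dominoes $d_0,d_1$ put $\tau^u(d_0,d_1)=\frac14\det(v(d_1),v(d_0),u)$ if $d_1\cap S^u(d_0)\neq\emptyset$, and $\tau^u(d_0,d_1)=0$ otherwise. The $u$-pretwist of a tiling $t$ is $T^u(t)=\sum_{d_0,d_1\in t}\tau^u(d_0,d_1)$, the sum over all ordered pairs. Let $\pi$ be a plane $x=c$, $y=c$ or $z=c$ with $c\in\mathbb{Z}$, with normal vector $w\in\{e_x,e_y,e_z\}$. A basic square of $\pi$ is a closed unit square $Q\subset\pi$ with vertices in $\mathbb{Z}^3$; it has the color of the basic cube $Q-[0,1]w$.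 A planar region $D\subset\pi$ is a finite union of basic squares of $\pi$. For a real number $N$, put $D+[0,N]w=\{p+sw : p\in D,\ 0\le s\le N\}$. **Proposition.** Let $D\subset\pi$ be a planar region whose interior (relative to $\pi$) is connected (in particular nonempty) and such that $D$ contains exactly $n$ black basic squares and exactly $n$ white basic squares. Then $D+[0,2n-1]w$ is tileable, and more generally $D+[0,2k-1]w$ is tileable for each integer $k\ge n$. Moreover, for each $k\in\mathbb{N}$ such that $D+[0,2k-1]w$ is tileable, every tiling $t$ of $D+[0,2k-1]w$ satisfies $$T^{e_x}(t)=T^{e_y}(t)=T^{e_z}(t)\in\mathbb{Z}.$$ -/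

import Mathlib

/-!
Domino brick tilings of cubiculated regions of three-dimensional space, the effect of one domino
on another along a coordinate direction, and the pretwists of a tiling.
-/

namespace DominoBrick

/-- Three-dimensional real space (only its vector space structure and its topology are used). -/
abbrev Space : Type := Fin 3 → ℝ

/-- The lattice of integer points. -/
abbrev Lattice : Type := Fin 3 → ℤ

/-- The canonical basis vector with index `i`; the set of these three vectors is `Δ`. -/
def basisVec (i : Fin 3) : Lattice := Pi.single i 1

/-- The set `Φ` of the six vectors `± e_i`. -/
def Phi : Set Lattice := {u | ∃ i : Fin 3, u = basisVec i ∨ u = -basisVec i}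

/-- An integer vector, seen as a vector of `Space`. -/
def toSpace (p : Lattice) : Space := fun i => (p i : ℝ)

/-- The basic cube `p + [0,1]^3`. -/
def basicCube (p : Lattice) : Set Space :=
  {x | ∀ i, (p i : ℝ) ≤ x i ∧ x i ≤ (p i : ℝ) + 1}

/-- The basic cube `p + [0,1]^3` is white if the sum of the coordinates of `p` is even. -/
def IsWhiteCube (p : Lattice) : Prop := Even (∑ i, p i)

/-- The basic cube `p + [0,1]^3` is black if the sum of the coordinates of `p` is odd. -/
def IsBlackCube (p : Lattice) : Prop := Odd (∑ i, p i)

/-- A domino: a pair of basic cubes that share a face, that is, whose corners (equivalently, whose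
centers) differ by an element of `Φ`. Two such cubes always have opposite colors, so that a domino
is recorded by its white cube and its black cube. -/
@[ext]
structure Domino where
  white : Lattice
  black : Lattice
  isWhite : IsWhiteCube white
  isBlack : IsBlackCube black
  adjacent : black - white ∈ Phi

/-- The set of points of a domino, the union of its two cubes. -/
def Domino.carrier (d : Domino) : Set Space := basicCube d.white ∪ basicCube d.black

/-- The center of the black cube of a domino minus the center of its white cube. -/
def Domino.vec (d : Domino) : Lattice := d.black - d.white

/-- `t` is a tiling of the set `R`: the dominoes of `t` cover exactly `R` and have pairwise disjoint
interiors. (A tiling of a bounded region is automatically finite.) -/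
def IsTiling (R : Set Space) (t : Finset Domino) : Prop :=
  (⋃ d ∈ t, d.carrier) = R ∧
    ∀ d₀ ∈ t, ∀ d₁ ∈ t, d₀ ≠ d₁ → Disjoint (interior d₀.carrier) (interior d₁.carrier)

/-- The set `R` admits a tiling. -/
def IsTileable (R : Set Space) : Prop := ∃ t : Finset Domino, IsTiling R t

/-- The open `u`-shade of `X`, the interior of `(X + [0,∞) u) \ X`. -/
def shade (u : Space) (X : Set Space) : Set Space :=
  interior ({y | ∃ x ∈ X, ∃ s : ℝ, 0 ≤ s ∧ y = x + s • u} \ X)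

/-- The determinant of the matrix with rows `a`, `b`, `c`. -/
def det3 (a b c : Lattice) : ℤ := Matrix.det (Matrix.of ![a, b, c])

open Classical in
/-- The effect of the domino `d₀` on the domino `d₁` along `u`. -/
noncomputable def effect (u : Lattice) (d₀ d₁ : Domino) : ℚ :=
  if (d₁.carrier ∩ shade (toSpace u) d₀.carrier).Nonempty then
    (1 / 4 : ℚ) * (det3 d₁.vec d₀.vec u : ℚ)
  else 0

/-- The `u`-pretwist of a tiling: the sum of the effects over all ordered pairs of dominoes. -/
noncomputable def pretwist (u : Lattice) (t : Finset Domino) : ℚ :=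
  ∑ d₀ ∈ t, ∑ d₁ ∈ t, effect u d₀ d₁

/-- The basic plane of the points whose coordinate with index `w` equals the integer `k`; its
normal vector is `basisVec w`. -/
def basicPlane (w : Fin 3) (k : ℤ) : Set Space := {x | x w = (k : ℝ)}

/-- The basic square with normal vector `basisVec w` and smallest corner `p`. -/
def basicSquare (w : Fin 3) (p : Lattice) : Set Space :=
  {x | x w = (p w : ℝ) ∧ ∀ i, i ≠ w → (p i : ℝ) ≤ x i ∧ x i ≤ (p i : ℝ) + 1}

/-- A basic square `Q` with normal vector `basisVec w` and smallest corner `p` has the color of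
the basic cube `Q - [0,1] w`, whose smallest corner is `p - basisVec w`. -/
def IsBlackSquare (w : Fin 3) (p : Lattice) : Prop := IsBlackCube (p - basisVec w)

/-- See `IsBlackSquare`. -/
def IsWhiteSquare (w : Fin 3) (p : Lattice) : Prop := IsWhiteCube (p - basisVec w)

/-- A planar region: a finite union of basic squares of a basic plane, given by the smallest corners
of its squares. (A basic square of the plane that lies in a finite union of basic squares of the
plane is one of them, so the set of squares is determined by the union.) -/
structure PlanarRegion where
  axis : Fin 3
  height : ℤ
  squares : Finset Lattice
  mem_plane : ∀ p ∈ squares, p axis = height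

/-- The set of points of a planar region. -/
def PlanarRegion.carrier (D : PlanarRegion) : Set Space := ⋃ p ∈ D.squares, basicSquare D.axis p

/-- The normal vector, in `Δ`, of the basic plane of a planar region. -/
def PlanarRegion.normal (D : PlanarRegion) : Lattice := basisVec D.axis

/-- The interior of a planar region, as a subset of its basic plane. -/
def PlanarRegion.planeInterior (D : PlanarRegion) : Set (basicPlane D.axis D.height) :=
  interior ((Subtype.val : basicPlane D.axis D.height → Space) ⁻¹' D.carrier)

open Classical in
/-- The number of black squares of a planar region. -/
noncomputable def PlanarRegion.numBlack (D : PlanarRegion) : ℕ :=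
  (D.squares.filter (fun p => IsBlackSquare D.axis p)).card

open Classical in
/-- The number of white squares of a planar region. -/
noncomputable def PlanarRegion.numWhite (D : PlanarRegion) : ℕ :=
  (D.squares.filter (fun p => IsWhiteSquare D.axis p)).card

/-- The set `D + [0,N] w`, where `w` is the normal vector of the plane of `D`. -/
def PlanarRegion.cylinder (D : PlanarRegion) (N : ℝ) : Set Space :=
  {x | ∃ p ∈ D.carrier, ∃ s : ℝ, 0 ≤ s ∧ s ≤ N ∧ x = p + s • toSpace D.normal}

end DominoBrick

/-! A tiling is the same as a partition of the cubes of the cylinder into adjacent pairs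
(`isTiling_cylinder_iff`), so everything becomes combinatorial.

Equality of the pretwists. An effect along u is nonzero only for two orthogonal dominoes, both
perpendicular to u, having two cubes on a common line parallel to u; there is then exactly one such
pair of cubes. After symmetrizing, 4T^u is a sum over pairs of cubes with the kernel "sign on the
line along u" (`four_mul_pretwist`). This kernel is obtained by differencing K(x) = sign x₀ · sign
x₁ · sign x₂ in the two other directions, and the color-weighted sum over the cubes of a domino is
such a difference (`mul_sum_lineKer`). Hence 4T^u = -a_{u+1,u+2}, where a_{ij} is the antisymmetric
color-weighted K-form between dominoes of directions i and j. In a cylinder of odd height the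
alternating sum of K over every column vanishes, so the 3×3 matrix a has zero row sums
(`sum_colorForm_eq_zero`). An antisymmetric 3×3 matrix with zero row sums satisfies a₀₁ = a₁₂ = a₂₀.

Integrality. Along the axis of the cylinder, 4T splits into contributions of columns. Modulo 4 a
contribution depends only on the numbers E, W, N, S of dominoes leaving the column in the four
horizontal directions (`column_sum`), and it is congruent to σ(E² + W² + N² + S² - 1) with σ the
color sign of the column (`zmod_four_identity`). Summed over the columns, each square occurs twice
with opposite signs, and the constants cancel because D is balanced.

Existence. Connected interior makes the adjacency graph of the squares connected
(`PlanarRegion.connected_graph`). Remove a square u of one color and then a square v of the other,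
keeping the rest connected. A path from u to v can be covered by horizontal dominoes that raise u
and v by 1 and its other squares by 2; vertical dominoes raise the squares off the path by 2. The
rest is flat and smaller, and induction gives total height 2n-1 (`raise_balanced`). Larger k only
adds vertical dominoes. -/

namespace DominoBrick

open Finset

/-! ### Cubes and generic points -/

/-- The two cubes of a domino. -/
def Domino.cells (d : Domino) : Finset Lattice := {d.white, d.black}

lemma Domino.mem_cells {d : Domino} {p : Lattice} : p ∈ d.cells ↔ p = d.white ∨ p = d.black := by
  simp [Domino.cells]

lemma Domino.mem_carrier {d : Domino} {x : Space} :
    x ∈ d.carrier ↔ ∃ p ∈ d.cells, x ∈ basicCube p := by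
  simp [Domino.carrier, Domino.mem_cells]

/-- The interior of a basic cube. -/
def openCube (p : Lattice) : Set Space := Set.univ.pi fun i => Set.Ioo (p i : ℝ) (p i + 1)

lemma mem_openCube {p : Lattice} {x : Space} :
    x ∈ openCube p ↔ ∀ i, (p i : ℝ) < x i ∧ x i < p i + 1 := by
  simp [openCube]

lemma isOpen_openCube (p : Lattice) : IsOpen (openCube p) :=
  isOpen_set_pi Set.finite_univ fun _ _ => isOpen_Ioo

lemma openCube_subset (p : Lattice) : openCube p ⊆ basicCube p := fun _ hx i =>
  ⟨(mem_openCube.1 hx i).1.le, (mem_openCube.1 hx i).2.le⟩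

lemma closure_openCube (p : Lattice) : closure (openCube p) = basicCube p := by
  rw [openCube, closure_pi_set]
  ext x
  simp [basicCube, Pi.le_def, forall_and]

lemma eq_of_mem_openCube {p q : Lattice} {x : Space} (hx : x ∈ openCube p)
    (hq : x ∈ basicCube q) : q = p := by
  funext i
  obtain ⟨h1, h2⟩ := mem_openCube.1 hx i
  obtain ⟨h3, h4⟩ := hq i
  have h5 : p i < q i + 1 := by exact_mod_cast h1.trans_le h4
  have h6 : q i < p i + 1 := by exact_mod_cast h3.trans_lt h2
  lia

/-- The center of a basic cube. -/
noncomputable def center (p : Lattice) : Space := fun i => p i + 1 / 2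

lemma center_mem (p : Lattice) : center p ∈ openCube p := by
  rw [mem_openCube]
  intro i
  simp only [center]
  constructor <;> linarith

lemma mem_carrier_iff {d : Domino} {p : Lattice} {x : Space} (hx : x ∈ openCube p) :
    x ∈ d.carrier ↔ p ∈ d.cells := by
  rw [Domino.mem_carrier]
  constructor
  · rintro ⟨q, hq, hxq⟩
    rwa [← eq_of_mem_openCube hx hxq]
  · exact fun h => ⟨p, h, openCube_subset p hx⟩

/-- Irrational coordinates supply general position: such a point lies on no face of a basic cube,
hence in the interior of every basic cube that contains it. -/
lemma exists_irrational_mem {U : Set Space} (hU : IsOpen U) (hne : U.Nonempty) :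
    ∃ x ∈ U, ∀ i, Irrational (x i) := by
  have h : Dense (Set.univ.pi fun _ : Fin 3 => {x : ℝ | Irrational x}) :=
    dense_pi _ fun _ _ => dense_irrational
  obtain ⟨x, hx, hxi⟩ := h.inter_open_nonempty U hU hne
  exact ⟨x, hx, fun i => hxi i trivial⟩

lemma mem_openCube_of_irrational {x : Space} (hx : ∀ i, Irrational (x i)) {p : Lattice}
    (hp : x ∈ basicCube p) : x ∈ openCube p := by
  rw [mem_openCube]
  refine fun i => ⟨lt_of_le_of_ne (hp i).1 ?_, lt_of_le_of_ne (hp i).2 ?_⟩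
  · exact fun h => hx i ⟨p i, by simp [h]⟩
  · exact fun h => hx i ⟨p i + 1, by simp [h]⟩

lemma openCube_subset_interior {d : Domino} {p : Lattice} (hp : p ∈ d.cells) :
    openCube p ⊆ interior d.carrier :=
  interior_maximal (fun _ hx => (mem_carrier_iff hx).2 hp) (isOpen_openCube p)

/-! ### Tilings by cells -/

/-- `t` partitions the finite set of cubes `R`. -/
structure IsCellTiling (R : Finset Lattice) (t : Finset Domino) : Prop where
  mem_iff : ∀ p, p ∈ R ↔ ∃ d ∈ t, p ∈ d.cells
  unique : ∀ d₀ ∈ t, ∀ d₁ ∈ t, ∀ p, p ∈ d₀.cells → p ∈ d₁.cells → d₀ = d₁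

/-- The center of a cube tells which dominoes cover it. Conversely, overlapping interiors contain a
generic point, which forces a whole common cube. -/
lemma isTiling_iff (R : Finset Lattice) (t : Finset Domino) :
    IsTiling (⋃ p ∈ R, basicCube p) t ↔ IsCellTiling R t := by
  constructor
  · rintro ⟨h1, h2⟩
    refine ⟨fun p => ?_, fun d₀ h₀ d₁ h₁ p hp₀ hp₁ => ?_⟩
    · have h3 : center p ∈ ⋃ p ∈ R, basicCube p ↔ p ∈ R := by
        simp only [Set.mem_iUnion, exists_prop]
        constructor
        · rintro ⟨q, hq, hx⟩
          rwa [← eq_of_mem_openCube (center_mem p) hx]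
        · exact fun h => ⟨p, h, openCube_subset p (center_mem p)⟩
      rw [← h3, ← h1]
      simp only [Set.mem_iUnion, exists_prop, mem_carrier_iff (center_mem p)]
    · by_contra hne
      exact Set.disjoint_left.1 (h2 d₀ h₀ d₁ h₁ hne)
        (openCube_subset_interior hp₀ (center_mem p)) (openCube_subset_interior hp₁ (center_mem p))
  · rintro ⟨h1, h2⟩
    refine ⟨?_, fun d₀ h₀ d₁ h₁ hne => ?_⟩
    · ext x
      simp only [Set.mem_iUnion, exists_prop, Domino.mem_carrier, h1]
      constructor
      · rintro ⟨d, hd, p, hp, hx⟩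
        exact ⟨p, ⟨d, hd, hp⟩, hx⟩
      · rintro ⟨p, ⟨d, hd, hp⟩, hx⟩
        exact ⟨d, hd, p, hp, hx⟩
    · by_contra hcon
      rw [Set.not_disjoint_iff_nonempty_inter] at hcon
      obtain ⟨x, hx, hirr⟩ := exists_irrational_mem (isOpen_interior.inter isOpen_interior) hcon
      obtain ⟨p, hp, hxp⟩ := Domino.mem_carrier.1 (interior_subset hx.1)
      have hxp' := mem_openCube_of_irrational hirr hxp
      exact hne (h2 d₀ h₀ d₁ h₁ p hp ((mem_carrier_iff hxp').1 (interior_subset hx.2)))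

/-- The cubes of the cylinder of height `N`. -/
def PlanarRegion.cells (D : PlanarRegion) (N : ℕ) : Finset Lattice :=
  (D.squares ×ˢ range N).image fun x => x.1 + (x.2 : ℤ) • basisVec D.axis

lemma PlanarRegion.mem_cells {D : PlanarRegion} {N : ℕ} {p : Lattice} :
    p ∈ D.cells N ↔ ∃ c ∈ D.squares, ∃ h < N, p = c + (h : ℤ) • basisVec D.axis := by
  simp only [PlanarRegion.cells, mem_image, mem_product, mem_range, Prod.exists]
  constructor
  · rintro ⟨c, h, ⟨hc, hh⟩, rfl⟩
    exact ⟨c, hc, h, hh, rfl⟩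
  · rintro ⟨c, hc, h, hh, rfl⟩
    exact ⟨c, h, ⟨hc, hh⟩, rfl⟩

lemma basisVec_apply (i j : Fin 3) : basisVec i j = if j = i then 1 else 0 := by
  simp [basisVec, Pi.single_apply]

lemma cylinder_natCast (D : PlanarRegion) (N : ℕ) (hN : 0 < N) :
    D.cylinder N = ⋃ p ∈ D.cells N, basicCube p := by
  ext x
  simp only [PlanarRegion.cylinder, PlanarRegion.carrier, Set.mem_ofPred_eq, Set.mem_iUnion,
    exists_prop, PlanarRegion.mem_cells, PlanarRegion.normal]
  constructor
  · rintro ⟨y, ⟨c, hc, hy, hy'⟩, s, hs0, hsN, rfl⟩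
    obtain ⟨h, hh, h1, h2⟩ : ∃ h : ℕ, h < N ∧ (h : ℝ) ≤ s ∧ s ≤ h + 1 := by
      -- The top level s = N belongs to the cube of height N - 1, where the floor of s would
      -- overshoot.
      rcases hsN.eq_or_lt with rfl | hlt
      · refine ⟨N - 1, by lia, ?_, ?_⟩ <;> rw [Nat.cast_sub (by lia)] <;> simp
      · exact ⟨⌊s⌋₊, (Nat.floor_lt hs0).2 hlt, Nat.floor_le hs0, (Nat.lt_floor_add_one s).le⟩
    refine ⟨_, ⟨c, hc, h, hh, rfl⟩, fun i => ?_⟩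
    by_cases hi : i = D.axis
    · subst hi
      simp [basisVec_apply, toSpace, hy]
      constructor <;> linarith
    · simpa [basisVec_apply, toSpace, hi] using hy' i hi
  · rintro ⟨p, ⟨c, hc, h, hh, rfl⟩, hx⟩
    refine ⟨x - (x D.axis - c D.axis) • toSpace (basisVec D.axis), ⟨c, hc, ?_, ?_⟩,
      x D.axis - c D.axis, ?_, ?_, by simp⟩
    · simp [basisVec_apply, toSpace]
    · intro i hi
      simpa [basisVec_apply, toSpace, hi] using hx i
    · have := (hx D.axis).1
      simp [basisVec_apply] at this
      have h0 : (0 : ℝ) ≤ h := h.cast_nonneg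
      linarith
    · have := (hx D.axis).2
      simp [basisVec_apply] at this
      have h0 : (h : ℝ) + 1 ≤ N := by exact_mod_cast hh
      linarith

/-- For k = 0 both sides are empty: the real height is -1, and the natural subtraction truncates to
0 layers. -/
lemma cylinder_eq (D : PlanarRegion) (k : ℕ) :
    D.cylinder (2 * (k : ℝ) - 1) = ⋃ p ∈ D.cells (2 * k - 1), basicCube p := by
  rcases Nat.eq_zero_or_pos k with rfl | hk
  · ext x
    simp only [PlanarRegion.cylinder, PlanarRegion.cells]
    simp
    intro _ _ s h1 h2
    linarith
  · rw [← cylinder_natCast D _ (by lia), Nat.cast_sub (by lia)]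
    simp

lemma isTiling_cylinder_iff (D : PlanarRegion) (k : ℕ) (t : Finset Domino) :
    IsTiling (D.cylinder (2 * (k : ℝ) - 1)) t ↔ IsCellTiling (D.cells (2 * k - 1)) t := by
  rw [cylinder_eq, isTiling_iff]

/-! ### Shades -/

lemma Domino.vec_eq (d : Domino) : ∃ i, d.vec = basisVec i ∨ d.vec = -basisVec i := d.adjacent

/-- Orthogonality to u ensures that a translate of a cube of `d₀` by a positive multiple of u is not
again a cube of `d₀`, so that it is really in the shade. -/
lemma shade_nonempty_iff (u : Fin 3) (d₀ d₁ : Domino) (h0 : d₀.vec u = 0) :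
    (d₁.carrier ∩ shade (toSpace (basisVec u)) d₀.carrier).Nonempty ↔
      ∃ p ∈ d₀.cells, ∃ q ∈ d₁.cells, ∃ s : ℤ, 0 < s ∧ q = p + s • basisVec u := by
  constructor
  · rintro ⟨y, hy, hys⟩
    obtain ⟨q, hq, hyq⟩ := Domino.mem_carrier.1 hy
    -- The shade is open, so meeting the closed cube q it also meets the interior of q, and there at
    -- a generic point.
    rw [← closure_openCube] at hyq
    obtain ⟨z, hz, hirr⟩ := exists_irrational_mem (isOpen_interior.inter (isOpen_openCube q))
      (mem_closure_iff.1 hyq _ isOpen_interior hys)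
    obtain ⟨⟨x, hx, s, hs, rfl⟩, hxd⟩ := interior_subset hz.1
    obtain ⟨p, hp, hxp⟩ := Domino.mem_carrier.1 hx
    have hzq := mem_openCube.1 hz.2
    have hne : ∀ i, i ≠ u → q i = p i := by
      intro i hi
      have h1 := hzq i
      have h2 := hxp i
      have h3 := hirr i
      simp [toSpace, basisVec_apply, hi] at h1 h3
      have h5 : q i < p i + 1 := by exact_mod_cast h1.1.trans_le h2.2
      have h6 : p i < q i + 1 := by exact_mod_cast h2.1.trans_lt h1.2
      lia
    have hu : p u ≤ q u := by
      have h1 := hzq u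
      have h2 := hxp u
      simp [toSpace, basisVec_apply] at h1
      have h6 : p u < q u + 1 := by
        have : (p u : ℝ) < q u + 1 := by linarith
        exact_mod_cast this
      lia
    refine ⟨p, hp, q, hq, q u - p u, ?_, ?_⟩
    · rcases hu.eq_or_lt with h | h
      · exfalso
        have : q = p := by
          funext i
          by_cases hi : i = u
          · rw [hi, h]
          · exact hne i hi
        exact hxd ((mem_carrier_iff hz.2).2 (this ▸ hp))
      · lia
    · funext i
      by_cases hi : i = u
      · subst hi; simp [basisVec_apply]
      · simp [basisVec_apply, hi, hne i hi]
  · rintro ⟨p, hp, q, hq, s, hs, hqp⟩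
    refine ⟨center q, (mem_carrier_iff (center_mem q)).2 hq, ?_⟩
    refine interior_maximal ?_ (isOpen_openCube q) (center_mem q)
    intro z hz
    refine ⟨⟨z - (s : ℝ) • toSpace (basisVec u), ?_, s, by exact_mod_cast hs.le, by simp⟩, ?_⟩
    · refine (mem_carrier_iff (p := p) ?_).2 hp
      rw [mem_openCube] at hz ⊢
      intro i
      have := hz i
      simp [hqp] at this
      simp only [toSpace, Pi.sub_apply, Pi.smul_apply, smul_eq_mul]
      constructor <;> linarith
    · rw [mem_carrier_iff hz]
      intro hq0
      have h1 : q u = p u + s := by simp [hqp, basisVec_apply]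
      have h2 : d₀.black u = d₀.white u := by
        simpa [Domino.vec, sub_eq_zero] using h0
      rw [Domino.mem_cells] at hp hq0
      rcases hp with rfl | rfl <;> rcases hq0 with rfl | rfl <;> lia

/-! ### The pretwist as a sum over pairs of cubes -/

lemma det3_basisVec (a b : Lattice) (u : Fin 3) :
    det3 a b (basisVec u) = a (u + 1) * b (u + 2) - a (u + 2) * b (u + 1) := by
  fin_cases u <;> simp [det3, Matrix.det_fin_three, basisVec_apply]
  ring

lemma axis_cases (u i : Fin 3) : i = u ∨ i = u + 1 ∨ i = u + 2 := by
  revert u i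
  decide

lemma axis_ne (u : Fin 3) : u + 1 ≠ u ∧ u + 2 ≠ u ∧ u + 1 ≠ u + 2 := by
  revert u
  decide

lemma Domino.exists_black_eq (d : Domino) :
    ∃ (i : Fin 3) (σ : ℤ), (σ = 1 ∨ σ = -1) ∧ d.vec = σ • basisVec i ∧
      d.black = d.white + σ • basisVec i := by
  obtain ⟨i, h | h⟩ := d.vec_eq
  · exact ⟨i, 1, Or.inl rfl, by simp [h], by rw [one_smul, ← h]; simp [Domino.vec]⟩
  · exact ⟨i, -1, Or.inr rfl, by simp [h], by rw [neg_one_smul, ← h]; simp [Domino.vec]⟩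

lemma Domino.white_ne_black (d : Domino) : d.white ≠ d.black := by
  obtain ⟨i, σ, hσ, -, h⟩ := d.exists_black_eq
  intro h'
  have := congrFun (h'.trans h) i
  simp [basisVec_apply] at this
  lia

lemma Domino.sum_cells {M : Type*} [AddCommMonoid M] (d : Domino) (f : Lattice → M) :
    ∑ p ∈ d.cells, f p = f d.white + f d.black :=
  sum_pair d.white_ne_black

/-- The indicator of the open ray spanned by `basisVec u`. -/
def rayKer (u : Fin 3) (x : Lattice) : ℤ :=
  if x (u + 1) = 0 ∧ x (u + 2) = 0 ∧ 0 < x u then 1 else 0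

/-- The sign function on the line spanned by `basisVec u`, extended by zero. -/
def lineKer (u : Fin 3) (x : Lattice) : ℤ :=
  if x (u + 1) = 0 ∧ x (u + 2) = 0 then (x u).sign else 0

lemma rayKer_sub_rayKer_neg (u : Fin 3) (x : Lattice) :
    rayKer u x - rayKer u (-x) = lineKer u x := by
  simp only [rayKer, lineKer, Pi.neg_apply, neg_eq_zero]
  rcases lt_trichotomy (x u) 0 with h | h | h
  · rw [Int.sign_eq_neg_one_of_neg h]; grind
  · simp [h]
  · rw [Int.sign_eq_one_of_pos h]; grind

lemma rayKer_eq (u : Fin 3) (x : Lattice) : rayKer u x =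
    (if x (u + 1) = 0 then 1 else 0) * (if x (u + 2) = 0 then 1 else 0) *
      (if 0 < x u then 1 else 0) := by
  rw [rayKer]
  split_ifs <;> simp_all

lemma shade_nonempty_iff_rayKer (u : Fin 3) (d₀ d₁ : Domino) (h0 : d₀.vec u = 0) :
    (d₁.carrier ∩ shade (toSpace (basisVec u)) d₀.carrier).Nonempty ↔
      ∃ p ∈ d₀.cells, ∃ q ∈ d₁.cells, rayKer u (q - p) = 1 := by
  rw [shade_nonempty_iff u d₀ d₁ h0]
  obtain ⟨n1, n2, n3⟩ := axis_ne u
  refine exists_congr fun p => and_congr_right fun _ => exists_congr fun q =>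
    and_congr_right fun _ => ⟨?_, ?_⟩
  · rintro ⟨s, hs, rfl⟩
    simp [rayKer, basisVec_apply, n1, n2, hs]
  · intro h
    simp only [rayKer, Pi.sub_apply] at h
    have h' := of_not_not fun hn => zero_ne_one ((if_neg hn).symm.trans h)
    refine ⟨q u - p u, h'.2.2, funext fun i => ?_⟩
    rcases axis_cases u i with rfl | rfl | rfl <;> simp [basisVec_apply, n1, n2] <;> lia

/-- When the determinant is nonzero, the projections of the two dominoes along u are orthogonal and
share at most one unit square, so the number of cube pairs on a ray is 0 or 1 and equals the
indicator that defines the effect. -/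
lemma four_mul_effect (u : Fin 3) (d₀ d₁ : Domino) :
    4 * effect (basisVec u) d₀ d₁ =
      ((d₁.vec (u + 1) * d₀.vec (u + 2) - d₁.vec (u + 2) * d₀.vec (u + 1)) *
        ∑ p ∈ d₀.cells, ∑ q ∈ d₁.cells, rayKer u (q - p) : ℤ) := by
  rw [effect, det3_basisVec]
  obtain ⟨n1, n2, n3⟩ := axis_ne u
  obtain ⟨i, σ, hσ, hv, hb⟩ := d₀.exists_black_eq
  obtain ⟨j, ρ, hρ, hv', hb'⟩ := d₁.exists_black_eq
  set δ := d₁.vec (u + 1) * d₀.vec (u + 2) - d₁.vec (u + 2) * d₀.vec (u + 1) with hδ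
  by_cases hδ0 : δ = 0
  · simp [hδ0]
  have hij : (i = u + 1 ∧ j = u + 2) ∨ (i = u + 2 ∧ j = u + 1) := by
    rw [hδ, hv, hv'] at hδ0
    rcases axis_cases u i with h | h | h <;> rcases axis_cases u j with h' | h' | h' <;>
      simp_all [basisVec_apply]
  have hu : d₀.vec u = 0 := by
    rw [hv]
    rcases hij with ⟨rfl, -⟩ | ⟨rfl, -⟩ <;> simp [basisVec_apply, n1.symm, n2.symm]
  rw [shade_nonempty_iff_rayKer u d₀ d₁ hu]
  have key : (∑ p ∈ d₀.cells, ∑ q ∈ d₁.cells, rayKer u (q - p)) =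
      if ∃ p ∈ d₀.cells, ∃ q ∈ d₁.cells, rayKer u (q - p) = 1 then 1 else 0 := by
    have hex : (∃ p ∈ d₀.cells, ∃ q ∈ d₁.cells, rayKer u (q - p) = 1) ↔
        rayKer u (d₁.white - d₀.white) = 1 ∨ rayKer u (d₁.black - d₀.white) = 1 ∨
        rayKer u (d₁.white - d₀.black) = 1 ∨ rayKer u (d₁.black - d₀.black) = 1 := by
      simp only [Domino.cells, mem_insert, mem_singleton, exists_eq_or_imp, exists_eq_left]
      tauto
    have h01 : ∀ x, rayKer u x = 0 ∨ rayKer u x = 1 := by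
      intro x
      rw [rayKer]
      split_ifs <;> simp
    have hsum : (∑ p ∈ d₀.cells, ∑ q ∈ d₁.cells, rayKer u (q - p)) ≤ 1 := by
      -- The count factors over the three coordinates: one domino varies coordinate u + 1, the other
      -- u + 2, and coordinate u of the difference is the same for all four pairs.
      obtain ⟨x, y, z, hx, hy, hz, h⟩ : ∃ x y z : ℤ, (x = 0 ∨ x = 1) ∧ (y = 0 ∨ y = 1) ∧
          (z = 0 ∨ z = 1) ∧ ∑ p ∈ d₀.cells, ∑ q ∈ d₁.cells, rayKer u (q - p) = x * y * z := by
        simp only [Domino.sum_cells, hb, hb', rayKer_eq, Pi.sub_apply, Pi.add_apply,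
          Pi.smul_apply, basisVec_apply, smul_eq_mul]
        generalize d₁.white = a
        generalize d₀.white = b
        have hone : ∀ x v : ℤ, (v = 1 ∨ v = -1) → ((if x = 0 then (1 : ℤ) else 0) +
            (if x + v = 0 then 1 else 0) = 0 ∨ (if x = 0 then (1 : ℤ) else 0) +
            (if x + v = 0 then 1 else 0) = 1) := by
          intro x v hv
          split_ifs <;> lia
        have hz : (if 0 < a u - b u then (1 : ℤ) else 0) = 0 ∨
            (if 0 < a u - b u then (1 : ℤ) else 0) = 1 := by
          split_ifs <;> simp
        have hσ' : -σ = 1 ∨ -σ = -1 := by lia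
        rcases hij with ⟨rfl, rfl⟩ | ⟨rfl, rfl⟩
        · refine ⟨_, _, _, hone (a (u + 1) - b (u + 1)) (-σ) hσ',
            hone (a (u + 2) - b (u + 2)) ρ hρ, hz, ?_⟩
          simp only [n1.symm, n2.symm, n3, n3.symm, if_true, if_false, mul_one, mul_zero, add_zero,
            ← sub_sub, ← sub_eq_add_neg, add_sub_right_comm _ ρ]
          ring
        · refine ⟨_, _, _, hone (a (u + 1) - b (u + 1)) ρ hρ,
            hone (a (u + 2) - b (u + 2)) (-σ) hσ', hz, ?_⟩
          simp only [n1.symm, n2.symm, n3, n3.symm, if_true, if_false, mul_one, mul_zero, add_zero,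
            ← sub_sub, ← sub_eq_add_neg, add_sub_right_comm _ ρ]
          ring
      rw [h]
      rcases hx with rfl | rfl <;> rcases hy with rfl | rfl <;> rcases hz with rfl | rfl <;> simp
    have e1 := h01 (d₁.white - d₀.white)
    have e2 := h01 (d₁.black - d₀.white)
    have e3 := h01 (d₁.white - d₀.black)
    have e4 := h01 (d₁.black - d₀.black)
    rw [if_congr hex rfl rfl]
    simp only [Domino.sum_cells] at hsum ⊢
    split_ifs <;> lia
  rw [key]
  split_ifs
  · push_cast; ring
  · simp

/-- The quadruple of the pretwist, as a sum over pairs of cubes of dominoes. -/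
def quadTwist (u : Fin 3) (t : Finset Domino) : ℤ :=
  ∑ d ∈ t, ∑ d' ∈ t, d.vec (u + 1) * d'.vec (u + 2) *
    ∑ p ∈ d.cells, ∑ q ∈ d'.cells, lineKer u (p - q)

/-- Swapping the dominoes in one of the two terms of the determinant reverses the ray; the
difference of the indicators of opposite rays is the sign on the line. -/
lemma four_mul_pretwist (u : Fin 3) (t : Finset Domino) :
    4 * pretwist (basisVec u) t = (quadTwist u t : ℚ) := by
  have h : quadTwist u t = ∑ d₀ ∈ t, ∑ d₁ ∈ t,
      (d₁.vec (u + 1) * d₀.vec (u + 2) - d₁.vec (u + 2) * d₀.vec (u + 1)) *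
        ∑ p ∈ d₀.cells, ∑ q ∈ d₁.cells, rayKer u (q - p) := by
    simp only [sub_mul, sum_sub_distrib]
    rw [sum_comm, ← sum_sub_distrib, quadTwist]
    refine sum_congr rfl fun d _ => ?_
    rw [← sum_sub_distrib]
    refine sum_congr rfl fun d' _ => ?_
    rw [sum_comm (s := d'.cells), mul_comm (d'.vec (u + 2)), ← mul_sub, ← sum_sub_distrib]
    congr 1
    refine sum_congr rfl fun p _ => ?_
    rw [← sum_sub_distrib]
    refine sum_congr rfl fun q _ => ?_
    rw [← rayKer_sub_rayKer_neg, neg_sub]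
  rw [pretwist, h, mul_sum]
  push_cast
  refine sum_congr rfl fun d _ => ?_
  rw [mul_sum]
  refine sum_congr rfl fun d' _ => ?_
  rw [four_mul_effect]
  push_cast
  rfl

/-! ### The three pretwists of a cylinder agree -/

/-- The color of a cube as a sign: white is `1` and black is `-1`. -/
def colorSign (p : Lattice) : ℤ := ((∑ i, p i).negOnePow : ℤ)

lemma Domino.colorSign_white (d : Domino) : colorSign d.white = 1 := by
  rw [colorSign, Int.negOnePow_even _ d.isWhite]; rfl

lemma Domino.colorSign_black (d : Domino) : colorSign d.black = -1 := by
  rw [colorSign, Int.negOnePow_odd _ d.isBlack]; rfl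

lemma sum_basisVec (i : Fin 3) : ∑ j, basisVec i j = 1 := by
  simp [basisVec_apply]

lemma colorSign_add_smul (p : Lattice) (h : ℤ) (i : Fin 3) :
    colorSign (p + h • basisVec i) = colorSign p * (h.negOnePow : ℤ) := by
  simp [colorSign, sum_add_distrib, ← mul_sum, sum_basisVec, Int.negOnePow_add]

/-- The product of the signs of the coordinates. -/
def signKer (x : Lattice) : ℤ := ∏ i, (x i).sign

lemma signKer_neg (x : Lattice) : signKer (-x) = -signKer x := by
  simp [signKer, Fin.prod_univ_three, Int.sign_neg]

/-- The effect of a pair of dominoes through `signKer`, weighted by the colors. -/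
def colorForm (d d' : Domino) : ℤ :=
  ∑ p ∈ d.cells, ∑ q ∈ d'.cells, colorSign p * colorSign q * signKer (p - q)

lemma colorForm_swap (d d' : Domino) : colorForm d' d = -colorForm d d' := by
  rw [colorForm, sum_comm, colorForm, ← sum_neg_distrib]
  refine sum_congr rfl fun p _ => ?_
  rw [← sum_neg_distrib]
  refine sum_congr rfl fun q _ => ?_
  rw [← neg_sub, signKer_neg]
  ring

/-- The jump of the sign function at 0 has size 2 and is shared equally by the unit steps entering
and leaving 0. -/
lemma sign_sub_sign_add (a v : ℤ) (hv : v = 1 ∨ v = -1) :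
    a.sign - (a + v).sign = -v * ((if a = 0 then 1 else 0) + (if a + v = 0 then 1 else 0)) := by
  rcases hv with rfl | rfl
  · rcases lt_trichotomy a 0 with h | h | h
    · rcases eq_or_ne a (-1) with rfl | h'
      · simp
      · rw [Int.sign_eq_neg_one_of_neg h, Int.sign_eq_neg_one_of_neg (by lia)]
        grind
    · simp [h]
    · rw [Int.sign_eq_one_of_pos h, Int.sign_eq_one_of_pos (by lia)]
      grind
  · rcases lt_trichotomy a 0 with h | h | h
    · rw [Int.sign_eq_neg_one_of_neg h, Int.sign_eq_neg_one_of_neg (by lia)]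
      grind
    · simp [h]
    · rcases eq_or_ne a 1 with rfl | h'
      · simp
      · rw [Int.sign_eq_one_of_pos h, Int.sign_eq_one_of_pos (by lia)]
        grind

lemma signKer_eq (u : Fin 3) (x : Lattice) :
    signKer x = (x u).sign * (x (u + 1)).sign * (x (u + 2)).sign := by
  fin_cases u <;> simp [signKer, Fin.prod_univ_three] <;> ring

lemma lineKer_eq (u : Fin 3) (x : Lattice) : lineKer u x =
    (x u).sign * (if x (u + 1) = 0 then 1 else 0) * (if x (u + 2) = 0 then 1 else 0) := by
  rw [lineKer]
  split_ifs <;> simp_all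

/-- The two cubes of a domino have opposite colors, so the color weights take differences of
`signKer` along the two dominoes. By `sign_sub_sign_add` each difference replaces a sign by the
indicators that the coordinate vanishes, leaving `lineKer`. -/
lemma mul_sum_lineKer (u : Fin 3) (d d' : Domino) :
    d.vec (u + 1) * d'.vec (u + 2) * ∑ p ∈ d.cells, ∑ q ∈ d'.cells, lineKer u (p - q) =
      -(d.vec (u + 1) ^ 2 * d'.vec (u + 2) ^ 2 * colorForm d d') := by
  obtain ⟨n1, n2, n3⟩ := axis_ne u
  obtain ⟨i, σ, hσ, hv, hb⟩ := d.exists_black_eq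
  obtain ⟨j, ρ, hρ, hv', hb'⟩ := d'.exists_black_eq
  by_cases hi : u + 1 = i
  swap
  · simp [hv, basisVec_apply, hi]
  by_cases hj : u + 2 = j
  swap
  · simp [hv', basisVec_apply, hj]
  subst hi hj
  simp only [colorForm, Domino.sum_cells, Domino.colorSign_white, Domino.colorSign_black]
  simp only [hb, hb', hv, hv', signKer_eq u, lineKer_eq, Pi.sub_apply, Pi.add_apply, Pi.smul_apply,
    basisVec_apply, smul_eq_mul, n3, n1.symm, n2.symm, n3.symm, if_true, if_false, mul_one,
    mul_zero, add_zero]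
  generalize d'.white = b
  generalize d.white = a
  have h1 := sign_sub_sign_add (a (u + 1) - b (u + 1)) σ hσ
  have h2 := sign_sub_sign_add (a (u + 2) - b (u + 2)) (-ρ) (by lia)
  rw [show a (u + 1) + σ - b (u + 1) = a (u + 1) - b (u + 1) + σ by ring,
    show a (u + 2) - (b (u + 2) + ρ) = a (u + 2) - b (u + 2) + -ρ by ring]
  have hσ2 : σ ^ 2 = 1 := by rcases hσ with rfl | rfl <;> rfl
  have hρ2 : ρ ^ 2 = 1 := by rcases hρ with rfl | rfl <;> rfl
  rw [hσ2, hρ2]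
  linear_combination (a u - b u).sign * (((a (u + 2) - b (u + 2)).sign -
    (a (u + 2) - b (u + 2) + -ρ).sign) * h1 + (-σ * ((if a (u + 1) - b (u + 1) = 0 then 1 else 0) +
    (if a (u + 1) - b (u + 1) + σ = 0 then 1 else 0))) * h2)

/-- The part of `colorForm` on dominoes of given directions. -/
def axisForm (t : Finset Domino) (i j : Fin 3) : ℤ :=
  ∑ d ∈ t, ∑ d' ∈ t, d.vec i ^ 2 * d'.vec j ^ 2 * colorForm d d'

lemma quadTwist_eq (u : Fin 3) (t : Finset Domino) :
    quadTwist u t = -axisForm t (u + 1) (u + 2) := by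
  simp only [quadTwist, axisForm, mul_sum_lineKer, sum_neg_distrib]

lemma axisForm_swap (t : Finset Domino) (i j : Fin 3) : axisForm t j i = -axisForm t i j := by
  rw [axisForm, sum_comm, axisForm, ← sum_neg_distrib]
  refine sum_congr rfl fun d _ => ?_
  rw [← sum_neg_distrib]
  refine sum_congr rfl fun d' _ => ?_
  rw [colorForm_swap]
  ring

lemma Domino.sum_vec_sq (d : Domino) : ∑ i, d.vec i ^ 2 = 1 := by
  obtain ⟨i, σ, hσ, hv, -⟩ := d.exists_black_eq
  have hσ2 : σ ^ 2 = 1 := by rcases hσ with rfl | rfl <;> rfl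
  simp [hv, basisVec_apply, hσ2]

/-- Each domino has exactly one direction, so the hypothesis says that the antisymmetric 3×3 matrix
`axisForm t` has zero row sums; its entries 01, 12 and 20 then agree. -/
lemma quadTwist_eq_of_sum_colorForm {t : Finset Domino}
    (h : ∀ d ∈ t, ∑ d' ∈ t, colorForm d d' = 0) (u v : Fin 3) : quadTwist u t = quadTwist v t := by
  have hrow : ∀ i, ∑ j, axisForm t i j = 0 := by
    intro i
    simp only [axisForm]
    rw [sum_comm]
    refine sum_eq_zero fun d hd => ?_
    rw [sum_comm]
    calc ∑ d' ∈ t, ∑ j, d.vec i ^ 2 * d'.vec j ^ 2 * colorForm d d'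
        = ∑ d' ∈ t, d.vec i ^ 2 * colorForm d d' := by
          refine sum_congr rfl fun d' _ => ?_
          rw [← sum_mul, ← mul_sum, d'.sum_vec_sq, mul_one]
      _ = 0 := by rw [← mul_sum, h d hd, mul_zero]
  have h0 := hrow 0
  have h1 := hrow 1
  simp only [Fin.sum_univ_three] at h0 h1
  have a00 := axisForm_swap t 0 0
  have a11 := axisForm_swap t 1 1
  have a01 := axisForm_swap t 0 1
  have a02 := axisForm_swap t 0 2
  have a12 := axisForm_swap t 1 2
  simp only [quadTwist_eq]
  fin_cases u <;> fin_cases v <;> simp <;> lia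

/-! ### Summation over the cubes of a tiling and over columns -/

lemma IsCellTiling.sum_ite {R : Finset Lattice} {t : Finset Domino} (ht : IsCellTiling R t)
    (p : Lattice) (x : ℤ) :
    ∑ d ∈ t, (if p ∈ d.cells then x else 0) = if p ∈ R then x else 0 := by
  split_ifs with hp
  · obtain ⟨d, hd, hpd⟩ := (ht.mem_iff p).1 hp
    rw [sum_eq_single_of_mem d hd, if_pos hpd]
    intro d' hd' hne
    exact if_neg fun h => hne (ht.unique d' hd' d hd p h hpd)
  · refine sum_eq_zero fun d hd => if_neg fun h => hp ((ht.mem_iff p).2 ⟨d, hd, h⟩)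

lemma IsCellTiling.sum_sum_cells {R : Finset Lattice} {t : Finset Domino} (ht : IsCellTiling R t)
    (f : Domino → Lattice → ℤ) :
    ∑ d ∈ t, ∑ p ∈ d.cells, f d p = ∑ p ∈ R, ∑ d ∈ t, if p ∈ d.cells then f d p else 0 := by
  rw [sum_comm]
  refine sum_congr rfl fun d hd => ?_
  rw [← sum_filter]
  refine sum_congr ?_ fun _ _ => rfl
  ext p
  simp only [mem_filter, iff_and_self]
  exact fun h => (ht.mem_iff p).2 ⟨d, hd, h⟩

lemma IsCellTiling.sum_cells {R : Finset Lattice} {t : Finset Domino} (ht : IsCellTiling R t)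
    (f : Lattice → ℤ) : ∑ d ∈ t, ∑ p ∈ d.cells, f p = ∑ p ∈ R, f p := by
  rw [ht.sum_sum_cells]
  refine sum_congr rfl fun p hp => ?_
  rw [ht.sum_ite, if_pos hp]

lemma PlanarRegion.cells_injOn (D : PlanarRegion) {c c' : Lattice} (hc : c ∈ D.squares)
    (hc' : c' ∈ D.squares) {h h' : ℕ}
    (heq : c + (h : ℤ) • basisVec D.axis = c' + (h' : ℤ) • basisVec D.axis) : c = c' ∧ h = h' := by
  have h1 := congrFun heq D.axis
  simp [basisVec_apply, D.mem_plane c hc, D.mem_plane c' hc'] at h1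
  subst h1
  exact ⟨add_right_cancel heq, rfl⟩

lemma PlanarRegion.sum_cells (D : PlanarRegion) (N : ℕ) (f : Lattice → ℤ) :
    ∑ p ∈ D.cells N, f p =
      ∑ c ∈ D.squares, ∑ h ∈ range N, f (c + (h : ℤ) • basisVec D.axis) := by
  rw [PlanarRegion.cells, sum_image, sum_product]
  rintro ⟨c, h⟩ hc ⟨c', h'⟩ hc' heq
  simp only [coe_product, Set.mem_prod, mem_coe] at hc hc'
  obtain ⟨rfl, rfl⟩ := D.cells_injOn hc.1 hc'.1 heq
  rfl

lemma sum_alternating_sign (a N : ℕ) :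
    ∑ h ∈ range N, (-1 : ℤ) ^ h * ((a : ℤ) - h).sign =
      if N ≤ a then ((N % 2 : ℕ) : ℤ) else 1 - ((N % 2 : ℕ) : ℤ) := by
  induction N with
  | zero => simp
  | succ N ih =>
    rw [sum_range_succ, ih]
    have hpow : (-1 : ℤ) ^ N = 1 - 2 * ((N % 2 : ℕ) : ℤ) := by
      rcases Nat.even_or_odd N with h | h
      · rw [h.neg_one_pow, Nat.even_iff.1 h]; rfl
      · rw [h.neg_one_pow, Nat.odd_iff.1 h]; rfl
    rw [hpow]
    rcases lt_trichotomy N a with h | h | h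
    · rw [Int.sign_eq_one_of_pos (by lia)]
      split_ifs <;> lia
    · subst h
      simp
      lia
    · rw [Int.sign_eq_neg_one_of_neg (by lia)]
      split_ifs <;> lia

/-- Here odd height enters: the blocks of heights below and above a have lengths of the same parity,
and their alternating sums cancel. -/
lemma sum_alternating_sign_eq_zero {a k : ℕ} (h : a < 2 * k - 1) :
    ∑ h ∈ range (2 * k - 1), (-1 : ℤ) ^ h * ((a : ℤ) - h).sign = 0 := by
  rw [sum_alternating_sign, if_neg (by lia), show (2 * k - 1) % 2 = 1 by lia]
  rfl

lemma colorSign_add_natCast_smul (p : Lattice) (h : ℕ) (i : Fin 3) :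
    colorSign (p + (h : ℤ) • basisVec i) = colorSign p * (-1) ^ h := by
  rw [colorSign_add_smul, Int.coe_negOnePow_natCast]

/-- For a fixed cube p of the cylinder, the color-weighted sum of `signKer` over each column is a
multiple of the alternating sign sum at the height of p, hence zero. -/
lemma sum_colorForm_eq_zero {D : PlanarRegion} {k : ℕ} {t : Finset Domino}
    (ht : IsCellTiling (D.cells (2 * k - 1)) t) {d : Domino} (hd : d ∈ t) :
    ∑ d' ∈ t, colorForm d d' = 0 := by
  simp only [colorForm]
  rw [sum_comm]
  refine sum_eq_zero fun p hp => ?_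
  rw [ht.sum_cells fun q => colorSign p * colorSign q * signKer (p - q), D.sum_cells]
  refine sum_eq_zero fun c hc => ?_
  obtain ⟨c₀, hc₀, a, ha, rfl⟩ := PlanarRegion.mem_cells.1 ((ht.mem_iff p).2 ⟨d, hd, hp⟩)
  have n := axis_ne D.axis
  have h0 := D.mem_plane c₀ hc₀
  have h1 := D.mem_plane c hc
  rw [← mul_zero (colorSign (c₀ + (a : ℤ) • basisVec D.axis) * colorSign c *
    ((c₀ - c) (D.axis + 1)).sign * ((c₀ - c) (D.axis + 2)).sign),
    ← sum_alternating_sign_eq_zero ha, mul_sum]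
  refine sum_congr rfl fun h _ => ?_
  rw [colorSign_add_natCast_smul c, signKer_eq D.axis]
  simp only [Pi.sub_apply, Pi.add_apply, Pi.smul_apply, basisVec_apply, smul_eq_mul, n.1, n.2.1,
    if_true, if_false, mul_one, mul_zero, add_zero, h0, h1, add_sub_add_left_eq_sub]
  ring

lemma quadTwist_eq_quadTwist {D : PlanarRegion} {k : ℕ} {t : Finset Domino}
    (ht : IsCellTiling (D.cells (2 * k - 1)) t) (u v : Fin 3) : quadTwist u t = quadTwist v t :=
  quadTwist_eq_of_sum_colorForm (fun _ hd => sum_colorForm_eq_zero ht hd) u v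

/-! ### Integrality of the pretwist of a cylinder -/

/-- The indicator that `d` consists of the cubes `p` and `p + basisVec i`. -/
def Domino.edgeInd (d : Domino) (i : Fin 3) (p : Lattice) : ℤ :=
  if p ∈ d.cells ∧ p + basisVec i ∈ d.cells then 1 else 0

lemma basisVec_ne_zero (i : Fin 3) : basisVec i ≠ 0 := fun h => by
  simpa [basisVec_apply] using congrFun h i

/-- Colors translate the white-to-black orientation of `vec` into an orientation away from p: the
color sign is positive when p is white and negative when p is black. -/
lemma Domino.edgeInd_add_edgeInd (d : Domino) (i : Fin 3) (p : Lattice) :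
    (if p ∈ d.cells then d.vec i else 0) =
      colorSign p * (d.edgeInd i p - d.edgeInd i (p - basisVec i)) ∧
    d.edgeInd i p + d.edgeInd i (p - basisVec i) = if p ∈ d.cells then d.vec i ^ 2 else 0 := by
  have hb : d.black = d.white + d.vec := by simp [Domino.vec]
  have hv : d.vec i = (if basisVec i = d.vec then 1 else 0) - (if -basisVec i = d.vec then 1 else 0) ∧
      d.vec i ^ 2 = (if basisVec i = d.vec then 1 else 0) + (if -basisVec i = d.vec then 1 else 0) := by
    obtain ⟨j, h | h⟩ := d.vec_eq <;> rw [h] <;> fin_cases i <;> fin_cases j <;>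
      simp [funext_iff, Fin.forall_fin_succ, basisVec_apply]
  have n0 := basisVec_ne_zero i
  by_cases hp : p ∈ d.cells
  · simp only [Domino.edgeInd, hp, if_true, true_and, sub_add_cancel, and_true]
    rcases Domino.mem_cells.1 hp with rfl | rfl
    · rw [d.colorSign_white, one_mul]
      simp only [Domino.mem_cells, hb, add_eq_left, n0, false_or, add_right_inj,
        sub_eq_add_neg d.white]
      simp only [neg_eq_zero, n0, false_or]
      exact ⟨hv.1, hv.2.symm⟩
    · have e1 : d.white + d.vec + basisVec i = d.white ↔ -basisVec i = d.vec := by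
        rw [add_assoc, add_eq_left, neg_eq_iff_add_eq_zero, add_comm]
      have e2 : d.white + d.vec - basisVec i = d.white ↔ basisVec i = d.vec := by
        rw [add_sub_assoc, add_eq_left, sub_eq_zero, eq_comm]
      rw [d.colorSign_black]
      simp only [Domino.mem_cells, hb, e1, e2, add_eq_left, sub_eq_self, n0, or_false]
      constructor
      · rw [hv.1]; ring
      · rw [hv.2]; ring
  · simp [Domino.edgeInd, hp]

/-- The indicator that a tiling contains the domino with cubes `p` and `p + basisVec i`. -/
def edgeInd (t : Finset Domino) (i : Fin 3) (p : Lattice) : ℤ := ∑ d ∈ t, d.edgeInd i p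

lemma edgeInd_nonneg (t : Finset Domino) (i : Fin 3) (p : Lattice) : 0 ≤ edgeInd t i p :=
  sum_nonneg fun d _ => by
    rw [Domino.edgeInd]
    split_ifs <;> simp

lemma sum_ite_vec (t : Finset Domino) (i : Fin 3) (p : Lattice) :
    (∑ d ∈ t, if p ∈ d.cells then d.vec i else 0) =
      colorSign p * (edgeInd t i p - edgeInd t i (p - basisVec i)) := by
  rw [edgeInd, edgeInd, ← sum_sub_distrib, mul_sum]
  exact sum_congr rfl fun d _ => (d.edgeInd_add_edgeInd i p).1

lemma IsCellTiling.sum_edgeInd {R : Finset Lattice} {t : Finset Domino} (ht : IsCellTiling R t)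
    {p : Lattice} (hp : p ∈ R) :
    ∑ i, (edgeInd t i p + edgeInd t i (p - basisVec i)) = 1 := by
  simp only [edgeInd, ← sum_add_distrib, fun d i => (Domino.edgeInd_add_edgeInd d i p).2]
  rw [sum_comm]
  calc _ = ∑ d ∈ t, if p ∈ d.cells then (1 : ℤ) else 0 := by
        refine sum_congr rfl fun d _ => ?_
        split_ifs
        · exact d.sum_vec_sq
        · simp
    _ = 1 := by rw [ht.sum_ite, if_pos hp]

lemma IsCellTiling.mem_of_edgeInd_ne_zero {R : Finset Lattice} {t : Finset Domino}
    (ht : IsCellTiling R t) {i : Fin 3} {p : Lattice} (h : edgeInd t i p ≠ 0) :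
    p ∈ R ∧ p + basisVec i ∈ R := by
  obtain ⟨d, hd, hne⟩ := exists_ne_zero_of_sum_ne_zero h
  have h' : p ∈ d.cells ∧ p + basisVec i ∈ d.cells := by
    by_contra hn
    exact hne (if_neg hn)
  exact ⟨(ht.mem_iff _).2 ⟨d, hd, h'.1⟩, (ht.mem_iff _).2 ⟨d, hd, h'.2⟩⟩

lemma IsCellTiling.quadTwist_eq_sum {R : Finset Lattice} {t : Finset Domino}
    (ht : IsCellTiling R t) (u : Fin 3) :
    quadTwist u t = ∑ p ∈ R, ∑ q ∈ R,
      colorSign p * (edgeInd t (u + 1) p - edgeInd t (u + 1) (p - basisVec (u + 1))) *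
      (colorSign q * (edgeInd t (u + 2) q - edgeInd t (u + 2) (q - basisVec (u + 2)))) *
      lineKer u (p - q) := by
  simp only [← sum_ite_vec]
  calc quadTwist u t = ∑ d ∈ t, ∑ p ∈ d.cells, d.vec (u + 1) *
        ∑ d' ∈ t, ∑ q ∈ d'.cells, d'.vec (u + 2) * lineKer u (p - q) := by
        refine sum_congr rfl fun d _ => ?_
        rw [← mul_sum, sum_comm, mul_sum]
        refine sum_congr rfl fun d' _ => ?_
        rw [mul_assoc]
        simp only [mul_sum]
    _ = _ := by
        rw [ht.sum_sum_cells]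
        refine sum_congr rfl fun p _ => ?_
        simp only [← ite_zero_mul]
        rw [← sum_mul, ht.sum_sum_cells, mul_sum]
        refine sum_congr rfl fun q _ => ?_
        simp only [← ite_zero_mul]
        rw [← sum_mul, mul_assoc]

/-- Along the axis, `lineKer` sees only pairs of cubes in the same column. -/
lemma PlanarRegion.sum_sum_cells_lineKer (D : PlanarRegion) (N : ℕ) (f g : Lattice → ℤ) :
    ∑ p ∈ D.cells N, ∑ q ∈ D.cells N, f p * g q * lineKer D.axis (p - q) =
      ∑ c ∈ D.squares, ∑ h ∈ range N, ∑ h' ∈ range N,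
        f (c + (h : ℤ) • basisVec D.axis) * g (c + (h' : ℤ) • basisVec D.axis) *
          ((h : ℤ) - h').sign := by
  rw [D.sum_cells]
  refine sum_congr rfl fun c hc => sum_congr rfl fun h _ => ?_
  rw [D.sum_cells]
  have n := axis_ne D.axis
  rw [sum_eq_single_of_mem c hc]
  · refine sum_congr rfl fun h' _ => ?_
    simp [lineKer, basisVec_apply, n]
  · intro c' hc' hne
    refine sum_eq_zero fun h' _ => ?_
    rw [lineKer, if_neg, mul_zero]
    rintro ⟨h1, h2⟩
    simp [basisVec_apply, n.1, n.2.1, sub_eq_zero] at h1 h2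
    refine hne (funext fun i => ?_)
    rcases axis_cases D.axis i with rfl | rfl | rfl
    · rw [D.mem_plane c hc, D.mem_plane c' hc']
    · exact h1.symm
    · exact h2.symm

/-- The alternating sign kernel on a column. -/
def altKer (h h' : ℕ) : ℤ := (-1) ^ h * (-1) ^ h' * ((h : ℤ) - h').sign

lemma altKer_swap (h h' : ℕ) : altKer h' h = -altKer h h' := by
  rw [altKer, altKer, ← neg_sub (h : ℤ) h', Int.sign_neg]
  ring

lemma altKer_eq_one_or {h h' : ℕ} (hne : h ≠ h') : altKer h h' = 1 ∨ altKer h h' = -1 := by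
  rw [altKer]
  rcases neg_one_pow_eq_or ℤ h with h1 | h1 <;> rcases neg_one_pow_eq_or ℤ h' with h2 | h2 <;>
    rcases lt_or_gt_of_ne hne with h3 | h3
  all_goals first
    | rw [h1, h2, Int.sign_eq_one_of_pos (by lia)]; simp
    | rw [h1, h2, Int.sign_eq_neg_one_of_neg (by lia)]; simp

lemma altKer_add_altKer_succ {h h' : ℕ} (h1 : h ≠ h') (h2 : h ≠ h' + 1) :
    altKer h h' + altKer h (h' + 1) = 0 := by
  rw [altKer, altKer, pow_succ (-1 : ℤ) h']
  rcases lt_or_gt_of_ne h1 with h3 | h3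
  · rw [Int.sign_eq_neg_one_of_neg (by lia), Int.sign_eq_neg_one_of_neg (by push_cast; lia)]
    ring
  · rw [Int.sign_eq_one_of_pos (by lia), Int.sign_eq_one_of_pos (by push_cast; lia)]
    ring

/-- The contribution of one column to the quadruple of the pretwist, modulo four. Here `E`, `W`,
`N`, `S` are the indicators of the horizontal directions of the dominoes at the cubes of the column
and `U h` indicates that a domino covers the cubes with heights `h - 1` and `h`. -/
lemma column_sum {k : ℕ} (hk : 0 < k) {E W N S U : ℕ → ℤ} (hE : ∀ h, 0 ≤ E h) (hW : ∀ h, 0 ≤ W h)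
    (hN : ∀ h, 0 ≤ N h) (hS : ∀ h, 0 ≤ S h) (hU : ∀ h, 0 ≤ U h) (hU0 : U 0 = 0)
    (hUk : U (2 * k - 1) = 0)
    (hdeg : ∀ h < 2 * k - 1, E h + W h + (N h + S h) + (U h + U (h + 1)) = 1) :
    (4 : ℤ) ∣ (∑ h ∈ range (2 * k - 1), ∑ h' ∈ range (2 * k - 1),
        altKer h h' * (E h - W h) * (N h' - S h')) -
      (2 * ((∑ h ∈ range (2 * k - 1), N h) * (∑ h ∈ range (2 * k - 1), E h) -
        (∑ h ∈ range (2 * k - 1), S h) * (∑ h ∈ range (2 * k - 1), W h)) -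
      2 * ((∑ h ∈ range (2 * k - 1), E h) + ∑ h ∈ range (2 * k - 1), W h) *
        ((∑ h ∈ range (2 * k - 1), N h) + ∑ h ∈ range (2 * k - 1), S h)) ∧
    Odd ((∑ h ∈ range (2 * k - 1), E h) + (∑ h ∈ range (2 * k - 1), W h) +
      (∑ h ∈ range (2 * k - 1), N h) + ∑ h ∈ range (2 * k - 1), S h) := by
  set n := 2 * k - 1 with hn
  have hshift : ∀ G : ℕ → ℤ, ∑ h ∈ range n, U h * G h = ∑ h ∈ range n, U (h + 1) * G (h + 1) := by
    intro G
    have h1 := sum_range_succ (fun h => U h * G h) n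
    have h2 := sum_range_succ' (fun h => U h * G h) n
    simp only [hU0, hUk, zero_mul, add_zero] at h1 h2
    rw [← h1, h2]
  -- If the cube at height h lies in an E or W domino, no vertical domino contains it. Every
  -- vertical domino of the column then lies entirely above or below h, so its two kernel values
  -- cancel; as the full row sum of `altKer` is zero, so is its part over horizontal dominoes.
  have hrow : ∀ h < n, (E h + W h) * ∑ h' ∈ range n, (E h' + W h' + (N h' + S h')) * altKer h h' =
      0 := by
    intro h hh
    by_cases hz : E h + W h = 0
    · rw [hz, zero_mul]
    have hd := hdeg h hh
    have hu : U h = 0 ∧ U (h + 1) = 0 := by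
      have p1 := hE h
      have p2 := hW h
      have p3 := hN h
      have p4 := hS h
      have p5 := hU h
      have p6 := hU (h + 1)
      lia
    obtain ⟨hu0, hu1⟩ := hu
    have htot : ∑ h' ∈ range n, altKer h h' = 0 := by
      simp only [altKer, mul_assoc]
      rw [← mul_sum, sum_alternating_sign_eq_zero hh, mul_zero]
    have hvert : ∑ h' ∈ range n, (U h' + U (h' + 1)) * altKer h h' = 0 := by
      simp only [add_mul, sum_add_distrib]
      rw [hshift, ← sum_add_distrib]
      refine sum_eq_zero fun h' _ => ?_
      rw [← mul_add]
      by_cases h1 : h = h'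
      · rw [← h1, hu1, zero_mul]
      by_cases h2 : h = h' + 1
      · rw [← h2, hu0, zero_mul]
      rw [add_comm (altKer _ _), altKer_add_altKer_succ h1 h2, mul_zero]
    rw [mul_eq_zero]
    right
    refine (add_eq_right.1 (Eq.trans ?_ (htot.trans hvert.symm)))
    rw [← sum_add_distrib]
    refine sum_congr rfl fun h' hh' => ?_
    linear_combination altKer h h' * hdeg h' (mem_range.1 hh')
  -- In `hrow` summed over h, the part pairing E, W with E, W vanishes by antisymmetry of `altKer`,
  -- leaving the mixed part.
  have hcross : ∑ h ∈ range n, ∑ h' ∈ range n, (E h + W h) * (N h' + S h') * altKer h h' = 0 := by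
    have h1 : ∑ h ∈ range n, ∑ h' ∈ range n, (E h + W h) * (E h' + W h') * altKer h h' = 0 := by
      have h2 : ∑ h ∈ range n, ∑ h' ∈ range n, (E h + W h) * (E h' + W h') * altKer h h' =
          -∑ h ∈ range n, ∑ h' ∈ range n, (E h + W h) * (E h' + W h') * altKer h h' := by
        conv_lhs => rw [sum_comm]
        rw [← sum_neg_distrib]
        refine sum_congr rfl fun h _ => ?_
        rw [← sum_neg_distrib]
        refine sum_congr rfl fun h' _ => ?_
        rw [altKer_swap]
        ring
      lia
    refine add_eq_right.1 (Eq.trans ?_ h1.symm)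
    rw [← sum_add_distrib]
    refine sum_eq_zero fun h hh => ?_
    rw [← sum_add_distrib, ← hrow h (mem_range.1 hh), mul_sum]
    exact sum_congr rfl fun h' _ => by ring
  constructor
  -- Termwise this is axy ≡ a + x + y - 2 modulo 4 for signs a = `altKer h h'`, x = E - W, y = N -
  -- S. The sum of the a-term is zero by `hcross`, and the other terms depend only on the column
  -- totals.
  · have hexp : (∑ h ∈ range n, ∑ h' ∈ range n, altKer h h' * (E h - W h) * (N h' - S h')) -
        (2 * ((∑ h ∈ range n, N h) * (∑ h ∈ range n, E h) -
          (∑ h ∈ range n, S h) * (∑ h ∈ range n, W h)) -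
        2 * ((∑ h ∈ range n, E h) + ∑ h ∈ range n, W h) *
          ((∑ h ∈ range n, N h) + ∑ h ∈ range n, S h)) =
        ∑ h ∈ range n, ∑ h' ∈ range n, (altKer h h' * (E h - W h) * (N h' - S h') -
          ((E h + W h) * (N h' + S h') * altKer h h' + (E h - W h) * (N h' + S h') +
            (E h + W h) * (N h' - S h') - 2 * ((E h + W h) * (N h' + S h')))) := by
      simp only [add_mul, mul_add, sum_add_distrib] at hcross
      simp only [sum_sub_distrib, sum_add_distrib, ← mul_sum, ← sum_mul, add_mul, mul_add,
        sub_mul, mul_sub]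
      linear_combination hcross
    rw [hexp]
    refine dvd_sum fun h hh => dvd_sum fun h' hh' => ?_
    have hd := hdeg h (mem_range.1 hh)
    have hd' := hdeg h' (mem_range.1 hh')
    have p1 := hE h
    have p2 := hW h
    have p3 := hN h
    have p4 := hS h
    have p5 := hU h
    have p6 := hU (h + 1)
    have q1 := hE h'
    have q2 := hW h'
    have q3 := hN h'
    have q4 := hS h'
    have q5 := hU h'
    have q6 := hU (h' + 1)
    have c1 : (E h = 0 ∧ W h = 0) ∨ (E h = 1 ∧ W h = 0) ∨ (E h = 0 ∧ W h = 1) := by lia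
    have c2 : (N h' = 0 ∧ S h' = 0) ∨ (N h' = 1 ∧ S h' = 0) ∨ (N h' = 0 ∧ S h' = 1) := by lia
    have c3 : (E h + W h = 1 ∧ N h' + S h' = 1) → altKer h h' = 1 ∨ altKer h h' = -1 := by
      rintro ⟨e1, e2⟩
      refine altKer_eq_one_or ?_
      rintro rfl
      lia
    rcases c1 with ⟨e1, e2⟩ | ⟨e1, e2⟩ | ⟨e1, e2⟩ <;>
      rcases c2 with ⟨e3, e4⟩ | ⟨e3, e4⟩ | ⟨e3, e4⟩ <;>
      rw [e1, e2, e3, e4] at c3 ⊢ <;> ring_nf <;>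
      first
        | exact dvd_zero _
        | exact dvd_refl _
        | (rcases c3 (by norm_num) with e | e <;> simp [e])
  · have hsum : (∑ h ∈ range n, (E h + W h + (N h + S h) + (U h + U (h + 1)))) = n := by
      rw [sum_congr rfl fun h hh => hdeg h (mem_range.1 hh)]
      simp
    have hUU := hshift fun _ => 1
    simp only [mul_one] at hUU
    simp only [sum_add_distrib] at hsum
    rw [← hUU] at hsum
    -- The vertical dominoes cover 2∑U of the 2k - 1 cubes of the column.
    exact ⟨k - 1 - ∑ h ∈ range n, U h, by lia⟩

/-- Translation by `basisVec i` matches the term f(c)² at c with the same square at the neighbor,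
which has the opposite color. -/
lemma sum_colorSign_mul_sq (s : Finset Lattice) (f : Lattice → ℤ) (i : Fin 3)
    (h1 : ∀ c ∈ s, f c ≠ 0 → c + basisVec i ∈ s)
    (h2 : ∀ c ∈ s, f (c - basisVec i) ≠ 0 → c - basisVec i ∈ s) :
    ∑ c ∈ s, colorSign c * (f c ^ 2 + f (c - basisVec i) ^ 2) = 0 := by
  simp only [mul_add, sum_add_distrib]
  rw [add_eq_zero_iff_eq_neg, ← sum_neg_distrib]
  have hcol : ∀ c, colorSign (c + basisVec i) = -colorSign c := by
    intro c
    have := colorSign_add_natCast_smul c 1 i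
    simpa using this
  refine sum_bij_ne_zero (fun c _ _ => c + basisVec i) ?_ ?_ ?_ ?_
  · intro c hc hne
    exact h1 c hc fun h => hne (by simp [h])
  · intro c _ _ c' _ _ h
    exact add_right_cancel h
  · intro c hc hne
    have hf : f (c - basisVec i) ≠ 0 := fun h => hne (by simp [h])
    refine ⟨c - basisVec i, h2 c hc hf, ?_, sub_add_cancel _ _⟩
    refine mul_ne_zero ?_ (pow_ne_zero _ hf)
    simp [colorSign]
  · intro c hc hne
    simp [hcol]

lemma PlanarRegion.mem_squares_of_mem_cells (D : PlanarRegion) {N h : ℕ} {c : Lattice}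
    (hc : c D.axis = D.height) (hmem : c + (h : ℤ) • basisVec D.axis ∈ D.cells N) :
    c ∈ D.squares := by
  obtain ⟨c', hc', h', -, heq⟩ := PlanarRegion.mem_cells.1 hmem
  have h1 := congrFun heq D.axis
  simp [basisVec_apply, hc, D.mem_plane c' hc'] at h1
  subst h1
  rwa [add_right_cancel heq]

/-- Since the total is odd, the last factor is even, so the sign σ does not matter modulo 4 and can
be chosen to make the sum over columns telescope. -/
lemma zmod_four_identity (E W N S : ℤ) (hodd : Odd (E + W + N + S)) (σ : ℤ)
    (hσ : σ = 1 ∨ σ = -1) :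
    (4 : ℤ) ∣ (2 * (N * E - S * W) - 2 * (E + W) * (N + S)) -
      σ * (E ^ 2 + W ^ 2 + (N ^ 2 + S ^ 2) - 1) := by
  -- The equation 2(a + b + c + d) = 2 expresses in `ZMod 4` that the total is odd.
  have key : ∀ a b c d : ZMod 4, 2 * (a + b + c + d) = 2 →
      2 * (c * a - d * b) - 2 * (a + b) * (c + d) - (a ^ 2 + b ^ 2 + (c ^ 2 + d ^ 2) - 1) = 0 ∧
      2 * (c * a - d * b) - 2 * (a + b) * (c + d) - -(a ^ 2 + b ^ 2 + (c ^ 2 + d ^ 2) - 1) = 0 := by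
    decide
  obtain ⟨m, hm⟩ := hodd
  have h4 : (4 : ZMod 4) = 0 := rfl
  have h := key E W N S (by
    have : ((E + W + N + S : ℤ) : ZMod 4) = ((2 * m + 1 : ℤ) : ZMod 4) := by rw [hm]
    push_cast at this
    rw [this]
    linear_combination (m : ZMod 4) * h4)
  refine (ZMod.intCast_zmod_eq_zero_iff_dvd _ 4).1 ?_
  rcases hσ with rfl | rfl
  · push_cast
    simpa using h.1
  · push_cast
    simpa using h.2

lemma colorSign_eq_one_or (p : Lattice) : colorSign p = 1 ∨ colorSign p = -1 := by
  rw [colorSign]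
  rcases Int.units_eq_one_or (∑ i, p i).negOnePow with h | h <;> rw [h] <;> simp

lemma four_dvd_quadTwist {D : PlanarRegion} {k : ℕ} {t : Finset Domino}
    (ht : IsCellTiling (D.cells (2 * k - 1)) t) (hk : 0 < k)
    (hbal : ∑ c ∈ D.squares, colorSign c = 0) : (4 : ℤ) ∣ quadTwist D.axis t := by
  have n := axis_ne D.axis
  rw [ht.quadTwist_eq_sum, D.sum_sum_cells_lineKer (2 * k - 1)
    (fun p => colorSign p * (edgeInd t (D.axis + 1) p -
      edgeInd t (D.axis + 1) (p - basisVec (D.axis + 1))))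
    (fun q => colorSign q * (edgeInd t (D.axis + 2) q -
      edgeInd t (D.axis + 2) (q - basisVec (D.axis + 2))))]
  set F : Fin 3 → Lattice → ℤ := fun i c =>
    ∑ h ∈ range (2 * k - 1), edgeInd t i (c + (h : ℤ) • basisVec D.axis) with hF
  have hF1 : ∀ i, i ≠ D.axis → ∀ c ∈ D.squares, F i c ≠ 0 → c + basisVec i ∈ D.squares := by
    intro i hi c hc hne
    obtain ⟨h, -, hh⟩ := exists_ne_zero_of_sum_ne_zero hne
    refine D.mem_squares_of_mem_cells (h := h) (N := 2 * k - 1) ?_ ?_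
    · simp [basisVec_apply, hi.symm, D.mem_plane c hc]
    · rw [add_right_comm]
      exact (ht.mem_of_edgeInd_ne_zero hh).2
  have hF2 : ∀ i, i ≠ D.axis → ∀ c ∈ D.squares, F i (c - basisVec i) ≠ 0 →
      c - basisVec i ∈ D.squares := by
    intro i hi c hc hne
    obtain ⟨h, -, hh⟩ := exists_ne_zero_of_sum_ne_zero hne
    refine D.mem_squares_of_mem_cells (h := h) (N := 2 * k - 1) ?_ ?_
    · simp [basisVec_apply, hi.symm, D.mem_plane c hc]
    · exact (ht.mem_of_edgeInd_ne_zero hh).1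
  -- A domino leaving one column enters a neighboring column, so the squared counts cancel in pairs
  -- by color; the constants -1 cancel by `hbal`.
  have hzero : ∑ c ∈ D.squares, colorSign c * (F (D.axis + 1) c ^ 2 +
      F (D.axis + 1) (c - basisVec (D.axis + 1)) ^ 2 + (F (D.axis + 2) c ^ 2 +
      F (D.axis + 2) (c - basisVec (D.axis + 2)) ^ 2) - 1) = 0 := by
    have s1 := sum_colorSign_mul_sq D.squares (F (D.axis + 1)) (D.axis + 1) (hF1 _ n.1) (hF2 _ n.1)
    have s2 := sum_colorSign_mul_sq D.squares (F (D.axis + 2)) (D.axis + 2) (hF1 _ n.2.1)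
      (hF2 _ n.2.1)
    simp only [mul_sub, mul_one, sum_sub_distrib, hbal, mul_add (colorSign _) (_ + _),
      sum_add_distrib (f := fun c => colorSign c * (F (D.axis + 1) c ^ 2 + _))]
    rw [s1, s2]
    rfl
  rw [← sub_zero (∑ c ∈ D.squares, _), ← hzero, ← sum_sub_distrib]
  refine dvd_sum fun c hc => ?_
  have hcol := column_sum hk
    (E := fun h => edgeInd t (D.axis + 1) (c + (h : ℤ) • basisVec D.axis))
    (W := fun h => edgeInd t (D.axis + 1) (c - basisVec (D.axis + 1) + (h : ℤ) • basisVec D.axis))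
    (N := fun h => edgeInd t (D.axis + 2) (c + (h : ℤ) • basisVec D.axis))
    (S := fun h => edgeInd t (D.axis + 2) (c - basisVec (D.axis + 2) + (h : ℤ) • basisVec D.axis))
    (U := fun h => edgeInd t D.axis (c + (h : ℤ) • basisVec D.axis - basisVec D.axis))
    (fun _ => edgeInd_nonneg _ _ _) (fun _ => edgeInd_nonneg _ _ _) (fun _ => edgeInd_nonneg _ _ _)
    (fun _ => edgeInd_nonneg _ _ _) (fun _ => edgeInd_nonneg _ _ _)
    (by
      by_contra hne
      obtain ⟨c', hc', h', -, heq⟩ := PlanarRegion.mem_cells.1 (ht.mem_of_edgeInd_ne_zero hne).1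
      have h1 := congrFun heq D.axis
      simp [basisVec_apply, D.mem_plane c hc, D.mem_plane c' hc'] at h1
      lia)
    (by
      by_contra hne
      have hmem := (ht.mem_of_edgeInd_ne_zero hne).2
      rw [sub_add_cancel] at hmem
      obtain ⟨c', hc', h', hlt, heq⟩ := PlanarRegion.mem_cells.1 hmem
      exact hlt.ne (D.cells_injOn hc hc' heq).2.symm)
    (by
      intro h hh
      have hs := ht.sum_edgeInd (PlanarRegion.mem_cells.2 ⟨c, hc, h, hh, rfl⟩)
      have hperm : ∀ f : Fin 3 → ℤ, ∑ i, f i = f (D.axis + 1) + f (D.axis + 2) + f D.axis := by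
        intro f
        generalize D.axis = u
        fin_cases u <;> simp [Fin.sum_univ_three] <;> ring
      rw [hperm] at hs
      have e : c + ((h + 1 : ℕ) : ℤ) • basisVec D.axis - basisVec D.axis =
          c + (h : ℤ) • basisVec D.axis := by
        push_cast
        rw [add_smul, one_smul]
        abel
      rw [e, sub_add_eq_add_sub, sub_add_eq_add_sub]
      linarith)
  have hid := zmod_four_identity _ _ _ _ hcol.2 (colorSign c) (colorSign_eq_one_or c)
  have hadd := dvd_add hcol.1 hid
  rw [sub_add_sub_cancel] at hadd
  convert hadd using 2
  refine sum_congr rfl fun h _ => sum_congr rfl fun h' _ => ?_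
  rw [colorSign_add_natCast_smul, colorSign_add_natCast_smul, altKer, sub_add_eq_add_sub,
    sub_add_eq_add_sub]
  have hsq : colorSign c * colorSign c = 1 := by
    rcases colorSign_eq_one_or c with h | h <;> rw [h] <;> rfl
  linear_combination ((-1) ^ h * (-1) ^ h' * ((h : ℤ) - h').sign *
    (edgeInd t (D.axis + 1) (c + (h : ℤ) • basisVec D.axis) -
      edgeInd t (D.axis + 1) (c + (h : ℤ) • basisVec D.axis - basisVec (D.axis + 1))) *
    (edgeInd t (D.axis + 2) (c + (h' : ℤ) • basisVec D.axis) -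
      edgeInd t (D.axis + 2) (c + (h' : ℤ) • basisVec D.axis - basisVec (D.axis + 2)))) * hsq

/-! ### Colors of squares and the balance condition -/

lemma sum_sub_basisVec (c : Lattice) (w : Fin 3) :
    ∑ i, (c - basisVec w) i = ∑ i, c i - 1 := by
  simp [sum_sub_distrib, sum_basisVec]

/-- A square takes the color of the cube below it, so a black square carries a white cube at height
0. -/
lemma isBlackSquare_iff (w : Fin 3) (c : Lattice) : IsBlackSquare w c ↔ colorSign c = 1 := by
  rw [IsBlackSquare, IsBlackCube, sum_sub_basisVec, colorSign, Units.val_eq_one,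
    Int.negOnePow_eq_one_iff, Int.odd_sub, iff_comm]
  simp

lemma isWhiteSquare_iff (w : Fin 3) (c : Lattice) : IsWhiteSquare w c ↔ colorSign c = -1 := by
  rw [IsWhiteSquare, IsWhiteCube, ← Int.not_odd_iff_even, ← IsBlackCube, ← IsBlackSquare,
    isBlackSquare_iff]
  rcases colorSign_eq_one_or c with h | h <;> rw [h] <;> decide

lemma PlanarRegion.numBlack_eq (D : PlanarRegion) :
    D.numBlack = (D.squares.filter fun c => colorSign c = 1).card := by
  simp only [PlanarRegion.numBlack, isBlackSquare_iff]

lemma PlanarRegion.numWhite_eq (D : PlanarRegion) :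
    D.numWhite = (D.squares.filter fun c => colorSign c = -1).card := by
  simp only [PlanarRegion.numWhite, isWhiteSquare_iff]

lemma PlanarRegion.sum_colorSign (D : PlanarRegion) :
    ∑ c ∈ D.squares, colorSign c = (D.numBlack : ℤ) - D.numWhite := by
  have h : ∀ c, colorSign c = (if colorSign c = 1 then 1 else 0) -
      (if colorSign c = -1 then 1 else 0) := by
    intro c
    rcases colorSign_eq_one_or c with h | h <;> rw [h] <;> rfl
  rw [sum_congr rfl fun c _ => h c, sum_sub_distrib, sum_boole, sum_boole, D.numBlack_eq,
    D.numWhite_eq]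

theorem exists_pretwist_eq {D : PlanarRegion} (hbal : D.numBlack = D.numWhite) {k : ℕ}
    {t : Finset Domino} (ht : IsTiling (D.cylinder (2 * (k : ℝ) - 1)) t) :
    ∃ m : ℤ, ∀ u : Fin 3, pretwist (basisVec u) t = m := by
  rw [isTiling_cylinder_iff] at ht
  obtain ⟨m, hm⟩ : (4 : ℤ) ∣ quadTwist D.axis t := by
    rcases Nat.eq_zero_or_pos k with rfl | hk
    · have : t = ∅ := by
        refine eq_empty_of_forall_notMem fun d hd => ?_
        have := (ht.mem_iff d.white).2 ⟨d, hd, Domino.mem_cells.2 (Or.inl rfl)⟩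
        simp [PlanarRegion.cells] at this
      simp [this, quadTwist]
    · exact four_dvd_quadTwist ht hk (by rw [D.sum_colorSign, hbal, sub_self])
  refine ⟨m, fun u => ?_⟩
  have h := four_mul_pretwist u t
  rw [quadTwist_eq_quadTwist ht u D.axis, hm] at h
  push_cast at h
  linarith

/-! ### Raising heights over a connected balanced graph -/

lemma walk_sign {V : Type*} {G : SimpleGraph V} {σ : V → ℤ}
    (hadj : ∀ x y, G.Adj x y → σ y = -σ x) {u v : V} (p : G.Walk u v) :
    σ v = (-1) ^ p.length * σ u := by
  induction p with
  | nil => simp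
  | cons h p ih => rw [ih, hadj _ _ h, SimpleGraph.Walk.length_cons, pow_succ]; ring

section Raise

variable {V : Type*} [DecidableEq V]

/-- Adding one domino on top of columns with given heights: a vertical one on a column of `T`, or a
horizontal one on two adjacent columns of `T` with the same height. -/
inductive RaiseStep (G : SimpleGraph V) (T : Finset V) : (V → ℕ) → (V → ℕ) → Prop
  | vertical (H : V → ℕ) (c : V) (hc : c ∈ T) : RaiseStep G T H (H + Pi.single c 2)
  | horizontal (H : V → ℕ) (c c' : V) (hc : c ∈ T) (hc' : c' ∈ T) (hadj : G.Adj c c')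
      (heq : H c = H c') : RaiseStep G T H (H + (Pi.single c 1 + Pi.single c' 1))

/-- Adding finitely many dominoes on top of columns with given heights. -/
def Raise (G : SimpleGraph V) (T : Finset V) : (V → ℕ) → (V → ℕ) → Prop :=
  Relation.ReflTransGen (RaiseStep G T)

variable {G : SimpleGraph V} {T : Finset V}

lemma Raise.trans {H H' H'' : V → ℕ} (h : Raise G T H H') (h' : Raise G T H' H'') :
    Raise G T H H'' := Relation.ReflTransGen.trans h h'

lemma raise_column {c : V} (hc : c ∈ T) (m : ℕ) (H : V → ℕ) :
    Raise G T H (H + Pi.single c (2 * m)) := by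
  induction m with
  | zero =>
    rw [mul_zero, Pi.single_zero, add_zero]
    exact .refl
  | succ m ih =>
    refine ih.tail ?_
    rw [mul_add, Pi.single_add, ← add_assoc]
    exact .vertical _ c hc

lemma raise_columns {A : Finset V} (hA : A ⊆ T) (m : ℕ) (H : V → ℕ) :
    Raise G T H (fun x => H x + if x ∈ A then 2 * m else 0) := by
  induction A using Finset.induction_on with
  | empty =>
    simp only [notMem_empty, if_false, add_zero]
    exact .refl
  | insert c A hc ih =>
    refine (ih ((subset_insert _ _).trans hA)).trans ?_
    convert raise_column (hA (mem_insert_self c A)) m _ using 1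
    funext x
    by_cases hx : x = c
    · subst hx
      simp [hc]
    · simp [hx]

/-- Induction two edges at a time. For a path u, x, y, ..., v, raise the tail from y to v first,
which puts y one level up; then a domino over u and x, and one more over x and y, which are now
level. -/
lemma raise_path : ∀ {u v : V} (p : G.Walk u v), p.IsPath → Odd p.length →
    (∀ x ∈ p.support, x ∈ T) → ∀ (H : V → ℕ) (a : ℕ), (∀ x ∈ p.support, H x = a) →
    Raise G T H (fun x => H x + if x = u ∨ x = v then 1 else if x ∈ p.support then 2 else 0)
  | _, _, .nil, _, hodd, _, _, _, _ => by simp at hodd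
  | u, v, .cons hadj .nil, _, _, hT, H, a, ha => by
    simp only [SimpleGraph.Walk.support_cons, SimpleGraph.Walk.support_nil] at hT ha
    refine Relation.ReflTransGen.single ?_
    convert RaiseStep.horizontal H u v (hT _ (by simp)) (hT _ (by simp)) hadj
      ((ha _ (by simp)).trans (ha _ (by simp)).symm) using 1
    funext x
    have := hadj.ne
    simp only [Pi.add_apply, Pi.single_apply, SimpleGraph.Walk.support_cons,
      SimpleGraph.Walk.support_nil]
    grind
  | u, v, .cons (v := x) h₁ (.cons (v := y) h₂ q), hp, hodd, hT, H, a, ha => by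
    rw [SimpleGraph.Walk.cons_isPath_iff, SimpleGraph.Walk.cons_isPath_iff] at hp
    obtain ⟨⟨hq, hx⟩, hu⟩ := hp
    simp only [SimpleGraph.Walk.support_cons, List.mem_cons, not_or] at hu hT ha
    have hodd' : Odd q.length := by
      simp only [SimpleGraph.Walk.length_cons] at hodd
      rcases hodd with ⟨m, hm⟩
      exact ⟨m - 1, by lia⟩
    have hy := q.start_mem_support
    have hv := q.end_mem_support
    have hyv : y ≠ v := by
      rintro rfl
      rw [(SimpleGraph.Walk.isPath_iff_nil.1 hq).length_eq_zero] at hodd'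
      simp at hodd'
    have r1 := raise_path q hq hodd' (fun z hz => hT z (Or.inr (Or.inr hz))) H a
      (fun z hz => ha z (Or.inr (Or.inr hz)))
    have hux := h₁.ne
    have hHu := ha u (Or.inl rfl)
    have hHx := ha x (Or.inr (Or.inl rfl))
    have hHy := ha y (Or.inr (Or.inr hy))
    have huy : u ≠ y := fun h => hu.2 (h ▸ hy)
    have hxy : x ≠ y := fun h => hx (h ▸ hy)
    have huv : u ≠ v := fun h => hu.2 (h ▸ hv)
    have hxv : x ≠ v := fun h => hx (h ▸ hv)
    refine (r1.tail (RaiseStep.horizontal _ u x (hT u (Or.inl rfl)) (hT x (Or.inr (Or.inl rfl))) h₁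
      ?_)).tail ?_
    · simp [hHu, hHx, huy, hxy, huv, hxv, hu.2, hx]
    · convert RaiseStep.horizontal _ x y (hT x (Or.inr (Or.inl rfl)))
        (hT y (Or.inr (Or.inr hy))) h₂ ?_ using 1
      · funext z
        simp only [Pi.add_apply, Pi.single_apply, SimpleGraph.Walk.support_cons, List.mem_cons]
        grind
      · simp [hHx, hHy, hxy, hxv, hx, hux.symm, hxy.symm, huy.symm]

/-- In a spanning tree the degrees over the color class s add up to the number of edges, |V| - 1 <
2|s|. So s contains a leaf of the tree, and deleting a leaf keeps the tree connected. -/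
lemma exists_connected_induce_compl [Fintype V] (hG : G.Connected) {s : Finset V}
    (hs : G.IsBipartiteWith s (sᶜ : Finset V)) (hcard : Fintype.card V ≤ 2 * s.card)
    (h2 : 2 ≤ Fintype.card V) : ∃ v ∈ s, (G.induce {v}ᶜ).Connected := by
  classical
  obtain ⟨K, hKG, hK⟩ := hG.exists_isTree_le
  have hKs : K.IsBipartiteWith s (sᶜ : Finset V) := ⟨hs.disjoint, fun _ _ h => hs.mem_of_adj (hKG h)⟩
  have hsum := SimpleGraph.isBipartiteWith_sum_degrees_eq_card_edges hKs
  have hedge := hK.card_edgeFinset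
  obtain ⟨v, hv, hlt⟩ : ∃ v ∈ s, K.degree v < 2 := by
    by_contra! hcon
    have := card_nsmul_le_sum s _ 2 hcon
    rw [smul_eq_mul] at this
    lia
  have : Nontrivial V := Fintype.one_lt_card_iff_nontrivial.1 h2
  have hpos := hK.connected.preconnected.degree_pos_of_nontrivial v
  exact ⟨v, hv, (hK.connected.induce_compl_singleton_of_degree_eq_one (by lia)).mono
    (SimpleGraph.comap_monotone _ hKG)⟩

lemma exists_connected_erase {σ : V → ℤ} (hσ : ∀ x, σ x = 1 ∨ σ x = -1)
    (hadj : ∀ x y, G.Adj x y → σ y = -σ x) {S : Finset V}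
    (hS : (G.induce (S : Set V)).Connected) {ε : ℤ} (hε : ε = 1 ∨ ε = -1)
    (hcard : S.card ≤ 2 * (S.filter fun x => σ x = ε).card) (h2 : 2 ≤ S.card) :
    ∃ v ∈ S, σ v = ε ∧ (G.induce ((S.erase v : Finset V) : Set V)).Connected := by
  classical
  have hcardS : Fintype.card (S : Set V) = S.card := by simp
  have hbip : (G.induce (S : Set V)).IsBipartiteWith
      (univ.filter fun x : (S : Set V) => σ x = ε : Finset (S : Set V))
      ((univ.filter fun x : (S : Set V) => σ x = ε)ᶜ : Finset (S : Set V)) := by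
    constructor
    · rw [disjoint_coe]
      exact disjoint_compl_right
    · intro x y hxy
      have h1 : σ (y : V) = -σ x := hadj _ _ hxy
      have h2 := hσ x
      have h3 := hσ y
      simp only [coe_compl, Set.mem_compl_iff, mem_coe, mem_filter, mem_univ, true_and]
      grind
  have hle : Fintype.card (S : Set V) ≤ 2 * (univ.filter fun x : (S : Set V) => σ x = ε).card := by
    rw [hcardS]
    refine hcard.trans_eq (congrArg _ (card_bij (fun x _ => x.1) ?_ ?_ ?_).symm)
    · intro x hx
      exact mem_filter.2 ⟨x.2, (mem_filter.1 hx).2⟩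
    · intro x _ y _ h
      exact Subtype.ext h
    · intro x hx
      exact ⟨⟨x, (mem_filter.1 hx).1⟩, mem_filter.2 ⟨mem_univ _, (mem_filter.1 hx).2⟩, rfl⟩
  obtain ⟨v, hv, hcon⟩ := exists_connected_induce_compl hS hbip hle (by rwa [hcardS])
  refine ⟨v, v.2, (mem_filter.1 hv).2, ?_⟩
  refine hcon.map (H := G.induce ((S.erase v : Finset V) : Set V))
    ⟨fun x => ⟨x.1.1, mem_coe.2 (mem_erase.2 ⟨fun h => x.2 (Subtype.ext h), x.1.2⟩)⟩,
      fun h => h⟩ ?_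
  rintro ⟨x, hx⟩
  rw [mem_coe, mem_erase] at hx
  exact ⟨⟨⟨x, hx.2⟩, fun h => hx.1 (congrArg Subtype.val h)⟩, rfl⟩

/-- Colors alternate along a walk, so a path between squares of opposite colors has odd length and
`raise_path` applies; the squares of S off the path get one vertical domino each. -/
lemma raise_pair {σ : V → ℤ} (hadj : ∀ x y, G.Adj x y → σ y = -σ x) {S : Finset V} (hST : S ⊆ T)
    (hS : (G.induce (S : Set V)).Connected) {u v : V} (hu : u ∈ S) (hv : v ∈ S) (hσu : σ u = 1)
    (hσv : σ v = -1) (H : V → ℕ) (a : ℕ) (ha : ∀ x ∈ S, H x = a) :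
    Raise G T H (fun x => H x + if x = u ∨ x = v then 1 else if x ∈ S then 2 else 0) := by
  obtain ⟨q, hq⟩ := hS.exists_isPath ⟨u, hu⟩ ⟨v, hv⟩
  obtain ⟨p, hp, hpS⟩ : ∃ p : G.Walk u v, p.IsPath ∧ ∀ x ∈ p.support, x ∈ S := by
    let f : G.induce (S : Set V) →g G := ⟨Subtype.val, fun h => h⟩
    refine ⟨q.map f, hq.map Subtype.val_injective, fun x hx => ?_⟩
    have hx' : x ∈ q.support.map f := (q.support_map f) ▸ hx
    obtain ⟨y, -, rfl⟩ := List.mem_map.1 hx'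
    exact y.2
  have hodd : Odd p.length := by
    have h := walk_sign hadj p
    rw [hσu, hσv, mul_one] at h
    by_contra hn
    rw [(Nat.not_odd_iff_even.1 hn).neg_one_pow] at h
    lia
  refine (raise_path p hp hodd (fun x hx => hST (hpS x hx)) H a fun x hx => ha x (hpS x hx)).trans ?_
  convert raise_columns (A := S.filter fun x => x ∉ p.support) ((filter_subset _ _).trans hST) 1 _
    using 1
  funext x
  have h1 := p.start_mem_support
  have h2 := p.end_mem_support
  have h3 := hpS x
  simp only [mem_filter]
  grind

lemma raise_balanced {σ : V → ℤ} (hσ : ∀ x, σ x = 1 ∨ σ x = -1)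
    (hadj : ∀ x y, G.Adj x y → σ y = -σ x) (m : ℕ) : ∀ S : Finset V, S ⊆ T →
    (G.induce (S : Set V)).Connected → (S.filter fun x => σ x = 1).card = m + 1 →
    (S.filter fun x => σ x = -1).card = m + 1 → ∀ (H : V → ℕ) (a : ℕ), (∀ x ∈ S, H x = a) →
    Raise G T H (fun x => H x + if x ∈ S then 2 * m + 1 else 0) := by
  have hcard : ∀ S : Finset V, S.card =
      (S.filter fun x => σ x = 1).card + (S.filter fun x => σ x = -1).card := by
    intro S
    rw [← card_filter_add_card_filter_not (s := S) fun x => σ x = 1]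
    congr 2
    refine filter_congr fun x _ => ?_
    rcases hσ x with h | h <;> rw [h] <;> decide
  induction m with
  | zero =>
    intro S hST hS h1 h2 H a ha
    obtain ⟨u, hu⟩ := card_eq_one.1 h1
    obtain ⟨v, hv⟩ := card_eq_one.1 h2
    have hu' := mem_filter.1 (hu ▸ mem_singleton_self u : u ∈ S.filter fun x => σ x = 1)
    have hv' := mem_filter.1 (hv ▸ mem_singleton_self v : v ∈ S.filter fun x => σ x = -1)
    convert raise_pair hadj hST hS hu'.1 hv'.1 hu'.2 hv'.2 H a ha using 1
    funext x
    have hx : x ∈ S ↔ x = u ∨ x = v := by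
      constructor
      · intro hx
        rcases hσ x with h | h
        · exact Or.inl (mem_singleton.1 (hu ▸ mem_filter.2 ⟨hx, h⟩))
        · exact Or.inr (mem_singleton.1 (hv ▸ mem_filter.2 ⟨hx, h⟩))
      · rintro (rfl | rfl)
        exacts [hu'.1, hv'.1]
    by_cases h : x = u ∨ x = v <;> simp [hx, h]
  | succ m ih =>
    intro S hST hS h1 h2 H a ha
    have hc := hcard S
    obtain ⟨u, hu, hσu, hSu⟩ := exists_connected_erase hσ hadj hS (Or.inl rfl) (by lia) (by lia)
    have f1 : ((S.erase u).filter fun x => σ x = 1).card = m + 1 := by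
      rw [filter_erase, card_erase_of_mem (mem_filter.2 ⟨hu, hσu⟩), h1]
      lia
    have f2 : ((S.erase u).filter fun x => σ x = -1).card = m + 2 := by
      rw [filter_erase, erase_eq_of_notMem, h2]
      simp [hσu]
    have hc' := hcard (S.erase u)
    -- Once u is removed, the class of color -1 is a strict majority, so it also supplies a
    -- removable vertex.
    obtain ⟨v, hv, hσv, hSv⟩ := exists_connected_erase hσ hadj hSu (Or.inr rfl) (by lia) (by lia)
    have f3 : (((S.erase u).erase v).filter fun x => σ x = 1).card = m + 1 := by
      rw [filter_erase, erase_eq_of_notMem, f1]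
      simp [hσv]
    have f4 : (((S.erase u).erase v).filter fun x => σ x = -1).card = m + 1 := by
      rw [filter_erase, card_erase_of_mem (mem_filter.2 ⟨hv, hσv⟩), f2]
      lia
    have hvS := (mem_erase.1 hv).2
    have r1 := raise_pair hadj hST hS hu hvS hσu hσv H a ha
    have r2 := ih ((S.erase u).erase v) (((erase_subset _ _).trans (erase_subset _ _)).trans hST) hSv
      f3 f4 (fun x => H x + if x = u ∨ x = v then 1 else if x ∈ S then 2 else 0) (a + 2) (by
        intro x hx
        simp only [mem_erase] at hx
        simp [hx, ha x hx.2.2])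
    refine (r1.trans r2).trans ?_
    -- The columns u and v stand at a + 1 and the others at a + 2 + (2m + 1), so m + 1 vertical
    -- dominoes on each of u and v level everything at a + 2(m + 1) + 1.
    convert raise_columns (A := {u, v}) (by
      intro x hx
      rcases mem_insert.1 hx with rfl | hx
      · exact hST hu
      · rw [mem_singleton.1 hx]
        exact hST hvS) (m + 1) _ using 1
    funext x
    simp only [mem_insert, mem_singleton, mem_erase]
    grind

end Raise

/-! ### Tilings of regions under the graph of a height function -/

lemma exists_domino (p : Lattice) (i : Fin 3) :
    ∃ d : Domino, d.cells = {p, p + basisVec i} := by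
  have hsum : ∑ j, (p + basisVec i) j = ∑ j, p j + 1 := by
    simp [sum_add_distrib, sum_basisVec]
  rcases Int.even_or_odd (∑ j, p j) with h | h
  · refine ⟨⟨p, p + basisVec i, h, ?_, i, Or.inl (by simp)⟩, rfl⟩
    rw [IsBlackCube, hsum]
    exact h.add_one
  · refine ⟨⟨p + basisVec i, p, ?_, h, i, Or.inr (by simp)⟩, pair_comm _ _⟩
    rw [IsWhiteCube, hsum]
    exact h.add_one

lemma IsCellTiling.insert [DecidableEq Domino] {R R' : Finset Lattice} {t : Finset Domino}
    (ht : IsCellTiling R t) (d : Domino) (hd : ∀ p ∈ d.cells, p ∉ R)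
    (hR' : ∀ p, p ∈ R' ↔ p ∈ d.cells ∨ p ∈ R) : IsCellTiling R' (insert d t) := by
  constructor
  · intro p
    rw [hR', ht.mem_iff]
    simp
  · have key : ∀ d' ∈ t, ∀ p ∈ d'.cells, p ∉ d.cells := fun d' hd' p hp hpd =>
      hd p hpd ((ht.mem_iff p).2 ⟨d', hd', hp⟩)
    intro d₀ h₀ d₁ h₁ p hp₀ hp₁
    rcases mem_insert.1 h₀ with rfl | h₀' <;> rcases mem_insert.1 h₁ with rfl | h₁'
    · rfl
    · exact absurd hp₀ (key _ h₁' p hp₁)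
    · exact absurd hp₁ (key _ h₀' p hp₀)
    · exact ht.unique _ h₀' _ h₁' p hp₀ hp₁

/-- The cubes between a planar region and the graph of a height function. -/
def PlanarRegion.under (D : PlanarRegion) (H : Lattice → ℕ) : Finset Lattice :=
  D.squares.biUnion fun c => (range (H c)).image fun h : ℕ => c + (h : ℤ) • basisVec D.axis

lemma PlanarRegion.mem_under {D : PlanarRegion} {H : Lattice → ℕ} {p : Lattice} :
    p ∈ D.under H ↔ ∃ c ∈ D.squares, ∃ h < H c, p = c + (h : ℤ) • basisVec D.axis := by
  simp only [PlanarRegion.under, mem_biUnion, mem_image, mem_range]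
  refine exists_congr fun c => and_congr_right fun _ => exists_congr fun h =>
    and_congr_right fun _ => eq_comm

lemma PlanarRegion.mem_under_iff (D : PlanarRegion) (H : Lattice → ℕ) {c : Lattice}
    (hc : c ∈ D.squares) (h : ℕ) : c + (h : ℤ) • basisVec D.axis ∈ D.under H ↔ h < H c := by
  rw [PlanarRegion.mem_under]
  constructor
  · rintro ⟨c', hc', h', hlt, heq⟩
    obtain ⟨rfl, rfl⟩ := D.cells_injOn hc hc' heq
    exact hlt
  · exact fun hlt => ⟨c, hc, h, hlt, rfl⟩

/-- Two squares are adjacent if their corners differ by a basis vector tangent to the plane. -/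
def PlanarRegion.graph (D : PlanarRegion) : SimpleGraph Lattice where
  Adj c c' := ∃ i, i ≠ D.axis ∧ (c' = c + basisVec i ∨ c = c' + basisVec i)
  symm := ⟨fun _ _ ⟨i, hi, h⟩ => ⟨i, hi, h.symm⟩⟩
  loopless := ⟨fun c ⟨i, _, h⟩ => basisVec_ne_zero i (by simpa using h)⟩

lemma PlanarRegion.colorSign_adj (D : PlanarRegion) (c c' : Lattice) (h : D.graph.Adj c c') :
    colorSign c' = -colorSign c := by
  obtain ⟨i, -, rfl | rfl⟩ := h
  · simpa using colorSign_add_natCast_smul c 1 i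
  · have := colorSign_add_natCast_smul c' 1 i
    simp only [Nat.cast_one, one_smul, pow_one, mul_neg, mul_one] at this
    rw [this, neg_neg]

lemma exists_tiling_under_of_raiseStep {D : PlanarRegion} {H H' : Lattice → ℕ}
    (hstep : RaiseStep D.graph D.squares H H') (hH : ∃ t, IsCellTiling (D.under H) t) :
    ∃ t, IsCellTiling (D.under H') t := by
  classical
  obtain ⟨t, ht⟩ := hH
  -- Common to both kinds of step: a domino lying on or above the graph of H whose cubes are exactly
  -- those gained in passing to H'.
  have hext : ∀ (H' : Lattice → ℕ) (d : Domino), (∀ p ∈ d.cells, ∃ c ∈ D.squares, ∃ h : ℕ,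
      p = c + (h : ℤ) • basisVec D.axis) →
      (∀ c ∈ D.squares, ∀ h : ℕ, (c + (h : ℤ) • basisVec D.axis ∈ d.cells ∧ H c ≤ h) ∨ h < H c ↔
        h < H' c) → (∀ c ∈ D.squares, ∀ h : ℕ, c + (h : ℤ) • basisVec D.axis ∈ d.cells → H c ≤ h) →
      ∃ t, IsCellTiling (D.under H') t := by
    intro H' d hd h1 h2
    refine ⟨_, ht.insert d ?_ ?_⟩
    · intro p hp hpR
      obtain ⟨c, hc, h, hlt, rfl⟩ := PlanarRegion.mem_under.1 hpR
      exact absurd (h2 c hc h hp) hlt.not_ge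
    · intro p
      constructor
      · intro hp
        obtain ⟨c, hc, h, hlt, rfl⟩ := PlanarRegion.mem_under.1 hp
        rw [D.mem_under_iff H hc]
        rcases (h1 c hc h).2 hlt with h3 | h3
        · exact Or.inl h3.1
        · exact Or.inr h3
      · rintro (hp | hp)
        · obtain ⟨c, hc, h, rfl⟩ := hd p hp
          rw [D.mem_under_iff H' hc]
          exact (h1 c hc h).1 (Or.inl ⟨hp, h2 c hc h hp⟩)
        · obtain ⟨c, hc, h, hlt, rfl⟩ := PlanarRegion.mem_under.1 hp
          rw [D.mem_under_iff H' hc]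
          exact (h1 c hc h).1 (Or.inr hlt)
  cases hstep with
  | vertical c hc =>
    obtain ⟨d, hd⟩ := exists_domino (c + (H c : ℤ) • basisVec D.axis) D.axis
    have hd' : d.cells = {c + (H c : ℤ) • basisVec D.axis,
        c + ((H c + 1 : ℕ) : ℤ) • basisVec D.axis} := by
      rw [hd]
      push_cast
      rw [add_smul, one_smul, add_assoc]
    have hmem : ∀ c' ∈ D.squares, ∀ h : ℕ, c' + (h : ℤ) • basisVec D.axis ∈ d.cells ↔
        c' = c ∧ (h = H c ∨ h = H c + 1) := by
      intro c' hc' h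
      rw [hd', mem_insert, mem_singleton]
      constructor
      · rintro (heq | heq) <;> obtain ⟨rfl, rfl⟩ := D.cells_injOn hc' hc heq <;> simp
      · rintro ⟨rfl, rfl | rfl⟩ <;> simp
    refine hext _ d ?_ ?_ ?_
    · intro p hp
      rw [hd', mem_insert, mem_singleton] at hp
      rcases hp with rfl | rfl
      exacts [⟨c, hc, _, rfl⟩, ⟨c, hc, _, rfl⟩]
    · intro c' hc' h
      rw [hmem c' hc', Pi.add_apply, Pi.single_apply]
      split_ifs with hcc
      · subst hcc; lia
      · simp [hcc]
    · intro c' hc' h hh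
      obtain ⟨rfl, hh⟩ := (hmem c' hc' h).1 hh
      lia
  | horizontal c c' hc hc' hadj heq =>
    obtain ⟨d, hd⟩ : ∃ d : Domino, d.cells = {c + (H c : ℤ) • basisVec D.axis,
        c' + (H c : ℤ) • basisVec D.axis} := by
      obtain ⟨i, -, rfl | rfl⟩ := hadj
      · obtain ⟨d, hd⟩ := exists_domino (c + (H c : ℤ) • basisVec D.axis) i
        exact ⟨d, by rw [hd, add_right_comm]⟩
      · obtain ⟨d, hd⟩ := exists_domino (c' + (H (c' + basisVec i) : ℤ) • basisVec D.axis) i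
        exact ⟨d, by rw [hd, add_right_comm, pair_comm]⟩
    have hmem : ∀ c₁ ∈ D.squares, ∀ h : ℕ, c₁ + (h : ℤ) • basisVec D.axis ∈ d.cells ↔
        (c₁ = c ∨ c₁ = c') ∧ h = H c := by
      intro c₁ hc₁ h
      rw [hd, mem_insert, mem_singleton]
      constructor
      · rintro (heq | heq)
        · obtain ⟨rfl, rfl⟩ := D.cells_injOn hc₁ hc heq
          simp
        · obtain ⟨rfl, rfl⟩ := D.cells_injOn hc₁ hc' heq
          simp
      · rintro ⟨rfl | rfl, rfl⟩ <;> simp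
    have hne := hadj.ne
    refine hext _ d ?_ ?_ ?_
    · intro p hp
      rw [hd, mem_insert, mem_singleton] at hp
      rcases hp with rfl | rfl
      exacts [⟨c, hc, _, rfl⟩, ⟨c', hc', _, rfl⟩]
    · intro c₁ hc₁ h
      rw [hmem c₁ hc₁, Pi.add_apply, Pi.add_apply, Pi.single_apply, Pi.single_apply]
      by_cases e1 : c₁ = c
      · subst e1
        simp only [true_or, true_and, if_true, hne, if_false]
        lia
      · by_cases e2 : c₁ = c'
        · subst e2
          simp only [or_true, true_and, if_true, e1, if_false]
          lia
        · simp [e1, e2]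
    · intro c₁ hc₁ h hh
      obtain ⟨rfl | rfl, rfl⟩ := (hmem c₁ hc₁ h).1 hh
      · exact le_rfl
      · exact heq.symm.le

lemma exists_tiling_under_of_raise {D : PlanarRegion} {H : Lattice → ℕ}
    (hH : Raise D.graph D.squares (fun _ => 0) H) : ∃ t, IsCellTiling (D.under H) t := by
  induction hH with
  | refl =>
    refine ⟨∅, fun p => ?_, by simp⟩
    rw [PlanarRegion.mem_under]
    simp
  | tail _ hstep ih => exact exists_tiling_under_of_raiseStep hstep ih

/-! ### The squares of a region with connected interior -/

lemma PlanarRegion.exists_mem_basicSquare (D : PlanarRegion)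
    {x : basicPlane D.axis D.height} (hx : x ∈ D.planeInterior) :
    ∃ c ∈ D.squares, x.1 ∈ basicSquare D.axis c := by
  have h : x ∈ (Subtype.val : basicPlane D.axis D.height → Space) ⁻¹' D.carrier :=
    interior_subset (s := (Subtype.val : basicPlane D.axis D.height → Space) ⁻¹' D.carrier) hx
  simpa [PlanarRegion.carrier] using h

/-- Moving slightly from the interior point x towards the center of c stays in D and enters the open
square c, which meets no other square. -/
lemma PlanarRegion.mem_squares_of_mem_planeInterior (D : PlanarRegion)
    {x : basicPlane D.axis D.height} (hx : x ∈ D.planeInterior) {c : Lattice}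
    (hc : c D.axis = D.height) (hxc : x.1 ∈ basicSquare D.axis c) : c ∈ D.squares := by
  have hcont : Continuous fun s : ℝ => fun i => x.1 i + s * ((if i = D.axis then 0 else
      center c i - x.1 i)) := by fun_prop
  let γ : ℝ → basicPlane D.axis D.height := fun s =>
    ⟨fun i => x.1 i + s * (if i = D.axis then 0 else center c i - x.1 i), by
      have := x.2
      simp only [basicPlane, Set.mem_ofPred_eq] at this ⊢
      simp [this]⟩
  have hγ : Continuous γ := hcont.subtype_mk _
  have hγ0 : γ 0 = x := Subtype.ext (funext fun i => by simp [γ])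
  have hnhds : ∀ᶠ s in nhdsWithin (0 : ℝ) (Set.Ioi 0), γ s ∈ D.planeInterior := by
    refine (hγ.tendsto 0).mono_left nhdsWithin_le_nhds |>.eventually ?_
    rw [hγ0]
    exact isOpen_interior.mem_nhds hx
  obtain ⟨s, hs, hs0, hs1⟩ := (hnhds.and (Ioo_mem_nhdsGT (zero_lt_one' ℝ))).exists
  obtain ⟨c', hc', hsc'⟩ := D.exists_mem_basicSquare hs
  have heq : c' = c := by
    funext i
    by_cases hi : i = D.axis
    · rw [hi, hc, D.mem_plane c' hc']
    · have h1 := hsc'.2 i hi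
      have h2 := hxc.2 i hi
      simp only [γ, hi, if_false, center] at h1
      have h3 : (c i : ℝ) < x.1 i + s * (c i + 1 / 2 - x.1 i) := by nlinarith
      have h4 : x.1 i + s * (c i + 1 / 2 - x.1 i) < c i + 1 := by nlinarith
      have h5 : c' i < c i + 1 := by exact_mod_cast h1.1.trans_lt h4
      have h6 : c i < c' i + 1 := by exact_mod_cast h3.trans_le h1.2
      lia
  exact heq ▸ hc'

lemma isClosed_basicSquare (w : Fin 3) (p : Lattice) : IsClosed (basicSquare w p) := by
  have : basicSquare w p = {x : Space | x w = (p w : ℝ)} ∩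
      ⋂ i, ⋂ (_ : i ≠ w), {x : Space | (p i : ℝ) ≤ x i ∧ x i ≤ (p i : ℝ) + 1} := by
    ext x
    simp [basicSquare]
  rw [this]
  refine (isClosed_eq (continuous_apply w) continuous_const).inter
    (isClosed_iInter fun i => isClosed_iInter fun _ => ?_)
  exact (isClosed_le continuous_const (continuous_apply i)).inter
    (isClosed_le (continuous_apply i) continuous_const)

/-- The center of a square, as a point of the plane. -/
noncomputable def squareCenter (D : PlanarRegion) (c : Lattice) : basicPlane D.axis D.height :=
  ⟨fun i => if i = D.axis then D.height else c i + 1 / 2, by simp [basicPlane]⟩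

lemma squareCenter_mem (D : PlanarRegion) {c : Lattice} (hc : c ∈ D.squares) :
    squareCenter D c ∈ D.planeInterior ∧ (squareCenter D c).1 ∈ basicSquare D.axis c := by
  constructor
  · have hU : IsOpen ((Subtype.val : basicPlane D.axis D.height → Space) ⁻¹'
        {x : Space | ∀ i, i ≠ D.axis → (c i : ℝ) < x i ∧ x i < (c i : ℝ) + 1}) := by
      refine IsOpen.preimage continuous_subtype_val ?_
      have : {x : Space | ∀ i, i ≠ D.axis → (c i : ℝ) < x i ∧ x i < (c i : ℝ) + 1} =
          ⋂ i, ⋂ (_ : i ≠ D.axis), {x : Space | (c i : ℝ) < x i ∧ x i < (c i : ℝ) + 1} := by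
        ext x
        simp
      rw [this]
      refine isOpen_iInter_of_finite fun i => isOpen_iInter_of_finite fun _ => ?_
      exact (isOpen_lt continuous_const (continuous_apply i)).inter
        (isOpen_lt (continuous_apply i) continuous_const)
    refine interior_maximal ?_ hU ?_
    · intro x hx
      refine Set.mem_iUnion₂.2 ⟨c, hc, ?_, fun i hi => ⟨(hx i hi).1.le, (hx i hi).2.le⟩⟩
      rw [D.mem_plane c hc]
      exact x.2
    · intro i hi
      simp only [squareCenter, hi, if_false]
      constructor <;> linarith
  · refine ⟨by simp [squareCenter, D.mem_plane c hc], fun i hi => ?_⟩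
    simp only [squareCenter, hi, if_false]
    constructor <;> linarith

/-- Otherwise the squares reachable from a and the remaining ones form two closed sets covering the
connected interior, so some interior point x lies in a square c of the first kind and c' of the
second. -/
lemma PlanarRegion.connected_graph (D : PlanarRegion) (hD : IsConnected D.planeInterior) :
    (D.graph.induce (D.squares : Set Lattice)).Connected := by
  classical
  have hne : Nonempty (D.squares : Set Lattice) := by
    obtain ⟨x, hx⟩ := hD.nonempty
    obtain ⟨c, hc, -⟩ := D.exists_mem_basicSquare hx
    exact ⟨⟨c, hc⟩⟩
  refine (SimpleGraph.connected_iff _).2 ⟨fun a b => ?_, hne⟩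
  by_contra hab
  let P : Lattice → Prop := fun c => ∃ hc : c ∈ D.squares,
    (D.graph.induce (D.squares : Set Lattice)).Reachable a ⟨c, hc⟩
  have hP : ∀ c c', c ∈ D.squares → c' ∈ D.squares → (c' = c ∨ D.graph.Adj c c') →
      P c → P c' := by
    rintro c c' hc hc' (rfl | hadj) ⟨_, hr⟩
    · exact ⟨hc', hr⟩
    · refine ⟨hc', hr.trans (SimpleGraph.Adj.reachable ?_)⟩
      exact hadj
  let Z : Finset Lattice → Set (basicPlane D.axis D.height) := fun S =>
    Subtype.val ⁻¹' ⋃ c ∈ S, basicSquare D.axis c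
  have hZ : ∀ S, IsClosed (Z S) := fun S =>
    (S.finite_toSet.isClosed_biUnion fun c _ => isClosed_basicSquare _ c).preimage
      continuous_subtype_val
  have ha : P a := ⟨a.2, .refl _⟩
  have hb : ¬P b := fun ⟨_, h⟩ => hab h
  obtain ⟨x, hx, hx1, hx2⟩ := isPreconnected_closed_iff.1 hD.isPreconnected
    (Z (D.squares.filter P)) (Z (D.squares.filter fun c => ¬P c)) (hZ _) (hZ _)
    (by
      intro x hx
      obtain ⟨c, hc, hxc⟩ := D.exists_mem_basicSquare hx
      by_cases h : P c
      · exact Or.inl (Set.mem_iUnion₂.2 ⟨c, mem_filter.2 ⟨hc, h⟩, hxc⟩)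
      · exact Or.inr (Set.mem_iUnion₂.2 ⟨c, mem_filter.2 ⟨hc, h⟩, hxc⟩))
    ⟨squareCenter D a, (squareCenter_mem D a.2).1,
      Set.mem_iUnion₂.2 ⟨a, mem_filter.2 ⟨a.2, ha⟩, (squareCenter_mem D a.2).2⟩⟩
    ⟨squareCenter D b, (squareCenter_mem D b.2).1,
      Set.mem_iUnion₂.2 ⟨b, mem_filter.2 ⟨b.2, hb⟩, (squareCenter_mem D b.2).2⟩⟩
  obtain ⟨c, hc, hxc⟩ := Set.mem_iUnion₂.1 hx1
  obtain ⟨c', hc', hxc'⟩ := Set.mem_iUnion₂.1 hx2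
  rw [mem_filter] at hc hc'
  have n := axis_ne D.axis
  have hplane := D.mem_plane c hc.1
  have hplane' := D.mem_plane c' hc'.1
  -- If c and c' meet only at a corner, they need not be adjacent; c'' is an intermediate square. It
  -- contains the interior point x, hence belongs to D, and it equals or is adjacent to each of c
  -- and c'.
  let c'' : Lattice := Function.update c (D.axis + 1) (c' (D.axis + 1))
  have hc'' : c'' ∈ D.squares := by
    refine D.mem_squares_of_mem_planeInterior hx ?_ ?_
    · simp [c'', n.1.symm, hplane]
    · refine ⟨by simpa [c'', n.1.symm] using hxc.1, fun i hi => ?_⟩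
      by_cases h : i = D.axis + 1
      · simpa [c'', h] using hxc'.2 (D.axis + 1) n.1
      · simpa [c'', h] using hxc.2 i hi
  have hnear : ∀ i, i ≠ D.axis → c' i = c i ∨ c' i = c i + 1 ∨ c i = c' i + 1 := by
    intro i hi
    have h1 := hxc.2 i hi
    have h2 := hxc'.2 i hi
    have h3 : c i ≤ c' i + 1 := by exact_mod_cast h1.1.trans h2.2
    have h4 : c' i ≤ c i + 1 := by exact_mod_cast h2.1.trans h1.2
    lia
  have hstep : ∀ (p q : Lattice) (i : Fin 3), i ≠ D.axis → (∀ j, j ≠ i → q j = p j) →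
      (q i = p i ∨ q i = p i + 1 ∨ p i = q i + 1) → q = p ∨ D.graph.Adj p q := by
    intro p q i hi hj h
    rcases h with h | h | h
    · refine Or.inl (funext fun j => ?_)
      by_cases hji : j = i
      · rw [hji, h]
      · exact hj j hji
    · refine Or.inr ⟨i, hi, Or.inl (funext fun j => ?_)⟩
      by_cases hji : j = i
      · simp [hji, h, basisVec_apply]
      · simp [hj j hji, hji, basisVec_apply]
    · refine Or.inr ⟨i, hi, Or.inr (funext fun j => ?_)⟩
      by_cases hji : j = i
      · simp [hji, h, basisVec_apply]
      · simp [hj j hji, hji, basisVec_apply]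
  refine hc'.2 (hP c'' c' hc'' hc'.1 (hstep c'' c' (D.axis + 2) n.2.1 ?_ ?_)
    (hP c c'' hc.1 hc'' (hstep c c'' (D.axis + 1) n.1 ?_ ?_) hc.2))
  · intro j hj
    rcases axis_cases D.axis j with rfl | rfl | rfl
    · simp [c'', n.1.symm, hplane, hplane']
    · simp [c'']
    · exact absurd rfl hj
  · simpa [c'', n.2.2.symm] using hnear (D.axis + 2) n.2.1
  · intro j hj
    simp [c'', hj]
  · simpa [c''] using hnear (D.axis + 1) n.1

theorem isTileable_cylinder {D : PlanarRegion} (hD : IsConnected D.planeInterior)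
    (hbal : D.numBlack = D.numWhite) {k : ℕ} (hk : D.numBlack ≤ k) :
    IsTileable (D.cylinder (2 * (k : ℝ) - 1)) := by
  classical
  have hconn := D.connected_graph hD
  have hsum := And.intro D.numBlack_eq D.numWhite_eq
  -- Were there no black squares, balance would leave no squares at all, but the graph is nonempty.
  obtain ⟨m, hm⟩ : ∃ m, D.numBlack = m + 1 := by
    refine Nat.exists_eq_succ_of_ne_zero fun h0 => ?_
    obtain ⟨c, hc⟩ := hconn.nonempty
    rw [← hbal, h0, eq_comm, card_eq_zero, eq_comm (a := 0), card_eq_zero] at hsum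
    rcases colorSign_eq_one_or c with h | h
    · exact notMem_empty c (hsum.1 ▸ mem_filter.2 ⟨hc, h⟩)
    · exact notMem_empty c (hsum.2 ▸ mem_filter.2 ⟨hc, h⟩)
  have hraise := (raise_balanced (T := D.squares) colorSign_eq_one_or D.colorSign_adj m D.squares
    Subset.rfl hconn (by lia) (by lia) (fun _ => 0) 0 (fun _ _ => rfl)).trans
    (raise_columns Subset.rfl (k - (m + 1)) _)
  obtain ⟨t, ht⟩ := exists_tiling_under_of_raise hraise
  refine ⟨t, (isTiling_cylinder_iff D k t).2 ?_⟩
  convert ht using 1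
  ext p
  rw [PlanarRegion.mem_cells, PlanarRegion.mem_under]
  refine exists_congr fun c => and_congr_right fun hc => ?_
  simp only [hc, if_true]
  rw [show 0 + (2 * m + 1) + 2 * (k - (m + 1)) = 2 * k - 1 by lia]

end DominoBrick

theorem mainTheorem7 (D : DominoBrick.PlanarRegion) (hD : IsConnected D.planeInterior)
    (n : ℕ) (hblack : D.numBlack = n) (hwhite : D.numWhite = n) :
    DominoBrick.IsTileable (D.cylinder (2 * (n : ℝ) - 1)) ∧
    (∀ k : ℕ, n ≤ k → DominoBrick.IsTileable (D.cylinder (2 * (k : ℝ) - 1))) ∧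
    (∀ k : ℕ, ∀ t : Finset DominoBrick.Domino,
      DominoBrick.IsTiling (D.cylinder (2 * (k : ℝ) - 1)) t →
      ∃ m : ℤ,
        DominoBrick.pretwist (DominoBrick.basisVec 0) t = (m : ℚ) ∧
        DominoBrick.pretwist (DominoBrick.basisVec 1) t = (m : ℚ) ∧
        DominoBrick.pretwist (DominoBrick.basisVec 2) t = (m : ℚ)) := by
  have hbal : D.numBlack = D.numWhite := hblack.trans hwhite.symm
  refine ⟨DominoBrick.isTileable_cylinder hD hbal hblack.le,
    fun k hk => DominoBrick.isTileable_cylinder hD hbal (hblack.trans_le hk), fun k t ht => ?_⟩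
  obtain ⟨m, hm⟩ := DominoBrick.exists_pretwist_eq hbal ht
  exact ⟨m, hm 0, hm 1, hm 2⟩
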